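/- Let $G$ be a finite simple graph on $n \ge 2$ vertices with at least $\frac52(n-1)$ edges. Then $G$ contains two cycles whose lengths are consecutive even numbers (that is, for some even $m$ it contains a cycle of length $m$ and a cycle of length $m+2$), unless $4$ divides $n-1$ and every block of $G$ is a complete graph $K_5$; in this exceptional case $G$ contains no two such cycles. Here a cut-vertex of a graph is a vertex whose deletion increases the number of connected components, and a block of $G$ is a maximal connected subgraph $B$ of $G$ such that $B$ has no cut-vertex of its own. -/

import Mathlib

namespace EvenCycles

/-- A set `A` of vertices is a cut of `G` if `G - A` (the subgraph induced on the complement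
of `A`) has more components than `G`. It is used for finite graphs only. -/
def IsCut {V : Type*} (G : SimpleGraph V) (A : Set V) : Prop :=
  Nat.card G.ConnectedComponent < Nat.card (G.induce Aᶜ).ConnectedComponent

/-- A cut-vertex is a vertex that forms a cut. -/
def IsCutVertex {V : Type*} (G : SimpleGraph V) (v : V) : Prop :=
  IsCut G {v}

/-- A block of `G` is a maximal connected subgraph `B` of `G` such that `B`, as a graph of its
own, contains no cut-vertex. Maximality is for the subgraph order; a connected subgraph is
non-empty. -/
def IsBlock {V : Type*} (G : SimpleGraph V) (B : G.Subgraph) : Prop :=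
  Maximal (fun H : G.Subgraph => H.Connected ∧ ∀ v : H.verts, ¬ IsCutVertex H.coe v) B

/-- The subgraph `B` is a clique `K_5`. -/
def IsK5 {V : Type*} {G : SimpleGraph V} (B : G.Subgraph) : Prop :=
  Nonempty (B.coe ≃g (⊤ : SimpleGraph (Fin 5)))

/-- `G` contains a cycle of length `m`. -/
def HasCycleOfLength {V : Type*} (G : SimpleGraph V) (m : ℕ) : Prop :=
  ∃ (v : V) (c : G.Walk v v), c.IsCycle ∧ c.length = m

/-- `G` contains two cycles whose lengths are consecutive even numbers. -/
def HasTwoConsecutiveEvenCycles {V : Type*} (G : SimpleGraph V) : Prop :=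
  ∃ m : ℕ, Even m ∧ HasCycleOfLength G m ∧ HasCycleOfLength G (m + 2)

end EvenCycles

/-! Call a vertex set `S` dense if `degSum G S ≥ 5 (|S| - 1)`, where `degSum` is twice the number of
induced edges. If `G` has no two cycles of consecutive even lengths, every nonempty dense set is a
`K5Tree`, that is, cliques of order five glued at single vertices (`k5Tree_of_dense`, by induction
on `S`). The excess `degSum G S - 5 (|S| - 1)` adds up when two sets are glued at a vertex, so a
separable dense set splits into dense pieces. In a nonseparable one with at least six vertices,
deleting a vertex of degree at most two, or two adjacent vertices of degree three, would leave a
dense set, hence a `K5Tree`. Any two vertices of a `K5Tree` are joined by paths of four consecutive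
lengths, so the deleted part is an ear that closes the two cycles. The induced graph is therefore
`Critical`.

A critical graph with at least six vertices always has the two cycles. The engine is
`Rooted.hasGap`: a connected set with roots `X` and `Y` contains two paths from `X` to one vertex at
`Y` whose lengths differ by two. It is applied to a component of `G - S` with roots `{u}` and `S \
{u}`. Closing both paths through `S` gives cycles whose lengths differ by two, and their parity can
be chosen if `S` is `Flexible`. The engine requires that no vertex of the component has two
neighbours in `S \ {u}`. For `S` a single edge this is vacuous, so there are two suitable even
cycles or an odd cycle. A shortest odd cycle is flexible. Where the requirement fails, either the
cycles appear directly or a triangle grows to a diamond and a diamond to a fan, for which 6-cycles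
settle the matter.

Conversely, every cycle lies in a block. If all blocks are `K_5`, no cycle is longer than five, but
the longer of two consecutive even cycles has length at least six. -/

namespace EvenCycles

open SimpleGraph

variable {V : Type*} {G : SimpleGraph V}

/-! ### Links, paths and cycles -/

/-- There is a walk from `a` to `b` all of whose vertices lie in `T`. -/
def LinkedIn (G : SimpleGraph V) (T : Set V) (a b : V) : Prop :=
  ∃ p : G.Walk a b, ∀ v ∈ p.support, v ∈ T

/-- There is a path of length `n` from `a` to `b` all of whose vertices lie in `T`. -/
def PathIn (G : SimpleGraph V) (T : Set V) (a b : V) (n : ℕ) : Prop :=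
  ∃ p : G.Walk a b, p.IsPath ∧ (∀ v ∈ p.support, v ∈ T) ∧ p.length = n

namespace LinkedIn

variable {T T' : Set V} {a b c : V}

theorem refl (h : a ∈ T) : LinkedIn G T a a :=
  ⟨Walk.nil, by simpa using h⟩

theorem left_mem (h : LinkedIn G T a b) : a ∈ T := by
  obtain ⟨p, hp⟩ := h
  exact hp _ p.start_mem_support

theorem right_mem (h : LinkedIn G T a b) : b ∈ T := by
  obtain ⟨p, hp⟩ := h
  exact hp _ p.end_mem_support

theorem symm (h : LinkedIn G T a b) : LinkedIn G T b a := by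
  obtain ⟨p, hp⟩ := h
  exact ⟨p.reverse, by simpa using hp⟩

theorem trans (h : LinkedIn G T a b) (h' : LinkedIn G T b c) : LinkedIn G T a c := by
  obtain ⟨p, hp⟩ := h
  obtain ⟨q, hq⟩ := h'
  refine ⟨p.append q, fun v hv => ?_⟩
  rcases (Walk.mem_support_append_iff p q).1 hv with h | h
  exacts [hp v h, hq v h]

theorem mono (hT : T ⊆ T') (h : LinkedIn G T a b) : LinkedIn G T' a b := by
  obtain ⟨p, hp⟩ := h
  exact ⟨p, fun v hv => hT (hp v hv)⟩

theorem cons (hab : G.Adj a b) (ha : a ∈ T) (h : LinkedIn G T b c) : LinkedIn G T a c := by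
  obtain ⟨p, hp⟩ := h
  refine ⟨Walk.cons hab p, fun v hv => ?_⟩
  rw [Walk.support_cons, List.mem_cons] at hv
  rcases hv with rfl | hv
  exacts [ha, hp v hv]

theorem adj (hab : G.Adj a b) (ha : a ∈ T) (hb : b ∈ T) : LinkedIn G T a b :=
  cons hab ha (refl hb)

theorem exists_pathIn (h : LinkedIn G T a b) : ∃ n, PathIn G T a b n := by
  classical
  obtain ⟨p, hp⟩ := h
  exact ⟨_, p.bypass, p.bypass_isPath, fun v hv => hp v (p.support_bypass_subset_support hv), rfl⟩

/-- Two linked vertices are separated by every set that contains exactly one of them. -/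
theorem exists_adj_of_mem_of_notMem {K : Set V} (h : LinkedIn G T a b) (ha : a ∈ K) (hb : b ∉ K) :
    ∃ u ∈ K, ∃ v, v ∉ K ∧ u ∈ T ∧ v ∈ T ∧ G.Adj u v := by
  obtain ⟨p, hp⟩ := h
  induction p with
  | nil => exact absurd ha hb
  | @cons u v w huv q ih =>
    by_cases hv : v ∈ K
    · exact ih hv hb fun x hx => hp x (by simp [hx])
    · exact ⟨u, ha, v, hv, hp _ (by simp), hp _ (by simp), huv⟩

/-- If nothing outside `K` in `T` is adjacent to `K`, a link from `K` stays in `K`. -/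
theorem restrict {K : Set V} (h : LinkedIn G T a b) (ha : a ∈ K)
    (hK : ∀ u ∈ K, ∀ v ∈ T, G.Adj u v → v ∈ K) : LinkedIn G K a b := by
  obtain ⟨p, hp⟩ := h
  induction p with
  | nil => exact refl ha
  | @cons u v w huv q ih =>
    exact cons huv ha (ih (hK u ha v (hp v (by simp)) huv) fun x hx => hp x (by simp [hx]))

/-- A link from `B` to `b` contains a link that meets `B` only in its first vertex. -/
theorem exists_last {B : Set V} (h : LinkedIn G T a b) (ha : a ∈ B) :
    ∃ c ∈ B, c ∈ T ∧ LinkedIn G (T \ B ∪ {c}) c b := by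
  obtain ⟨p, hp⟩ := h
  have key : (∃ c ∈ B, c ∈ T ∧ LinkedIn G (T \ B ∪ {c}) c b) ∨ LinkedIn G (T \ B) a b := by
    clear ha
    induction p with
    | @nil u =>
      by_cases hu : u ∈ B
      · exact Or.inl ⟨u, hu, hp _ (by simp), refl (by simp)⟩
      · exact Or.inr (refl ⟨hp _ (by simp), hu⟩)
    | @cons u v w huv q ih =>
      rcases ih fun x hx => hp x (by simp [hx]) with h | h
      · exact Or.inl h
      · by_cases hu : u ∈ B
        · exact Or.inl ⟨u, hu, hp _ (by simp), cons huv (by simp) (h.mono Set.subset_union_left)⟩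
        · exact Or.inr (cons huv ⟨hp _ (by simp), hu⟩ h)
  rcases key with h | h
  · exact h
  · exact absurd ha h.left_mem.2

end LinkedIn

/-- The component of `a` in the subgraph induced on `T`. -/
def comp (G : SimpleGraph V) (T : Set V) (a : V) : Set V :=
  {b | LinkedIn G T a b}

theorem comp_subset {T : Set V} {a : V} : comp G T a ⊆ T := fun _ h => h.right_mem

theorem comp_closed {T : Set V} {a : V} :
    ∀ u ∈ comp G T a, ∀ v ∈ T, G.Adj u v → v ∈ comp G T a :=
  fun _ hu _ hv huv => LinkedIn.trans hu (LinkedIn.adj huv hu.right_mem hv)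

theorem comp_connected {T : Set V} {a : V} :
    ∀ u ∈ comp G T a, ∀ v ∈ comp G T a, LinkedIn G (comp G T a) u v :=
  fun _ hu _ hv => (LinkedIn.trans (LinkedIn.symm hu) hv).restrict hu comp_closed

namespace PathIn

variable {T T' : Set V} {a b c d : V} {m n : ℕ}

theorem refl (h : a ∈ T) : PathIn G T a a 0 :=
  ⟨Walk.nil, by simp, by simpa using h, rfl⟩

theorem right_mem (h : PathIn G T a b n) : b ∈ T := by
  obtain ⟨p, -, hp, -⟩ := h
  exact hp _ p.end_mem_support

theorem symm (h : PathIn G T a b n) : PathIn G T b a n := by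
  obtain ⟨p, hp, hT, rfl⟩ := h
  exact ⟨p.reverse, hp.reverse, by simpa using hT, by simp⟩

theorem mono (hT : T ⊆ T') (h : PathIn G T a b n) : PathIn G T' a b n := by
  obtain ⟨p, hp, hpT, rfl⟩ := h
  exact ⟨p, hp, fun v hv => hT (hpT v hv), rfl⟩

theorem append (h : PathIn G T a b n) (h' : PathIn G T' b c m)
    (hd : ∀ v ∈ T, v ∈ T' → v = b) : PathIn G (T ∪ T') a c (n + m) := by
  obtain ⟨p, hp, hpT, rfl⟩ := h
  obtain ⟨q, hq, hqT, rfl⟩ := h'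
  refine ⟨p.append q, ?_, fun v hv => ?_, by simp⟩
  · rw [Walk.isPath_def, Walk.support_append]
    refine List.Nodup.append hp.support_nodup hq.support_nodup.tail fun v hv hv' => ?_
    obtain rfl := hd v (hpT v hv) (hqT v (List.mem_of_mem_tail hv'))
    have := hq.support_nodup
    rw [← Walk.cons_tail_support, List.nodup_cons] at this
    exact this.1 hv'
  · rcases (Walk.mem_support_append_iff p q).1 hv with h | h
    exacts [Or.inl (hpT v h), Or.inr (hqT v h)]

theorem single (hab : G.Adj a b) : PathIn G {a, b} a b 1 :=
  ⟨hab.toWalk, hab.isPath_toWalk, by simp, by simp⟩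

theorem cons (hab : G.Adj a b) (ha : a ∉ T) (h : PathIn G T b c n) :
    PathIn G (insert a T) a c (n + 1) := by
  obtain ⟨p, hp, hpT, rfl⟩ := h
  refine ⟨Walk.cons hab p, hp.cons fun h => ha (hpT _ h), fun v hv => ?_, by simp⟩
  rw [Walk.support_cons, List.mem_cons] at hv
  rcases hv with rfl | hv
  exacts [Or.inl rfl, Or.inr (hpT v hv)]

theorem append_adj (h : PathIn G T a b n) (hbc : G.Adj b c) (h' : PathIn G T' c d m)
    (hd : Disjoint T T') : PathIn G (T ∪ T') a d (n + m + 1) := by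
  have := (h.append (cons hbc (Set.disjoint_left.1 hd h.right_mem) h') ?_).mono
    (T' := T ∪ T') ?_
  · exact this
  · rintro v hv (rfl | hv')
    · rfl
    · exact absurd hv' (Set.disjoint_left.1 hd hv)
  · rintro v (hv | rfl | hv)
    exacts [Or.inl hv, Or.inl h.right_mem, Or.inr hv]

theorem pos_of_ne (h : PathIn G T a b n) (hab : a ≠ b) : 1 ≤ n := by
  obtain ⟨p, -, -, rfl⟩ := h
  rcases Nat.eq_zero_or_pos p.length with h0 | h0
  · exact absurd (Walk.eq_of_length_eq_zero h0) hab
  · exact h0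

theorem hasCycle (h : PathIn G T a b n) (hn : 2 ≤ n) (hba : G.Adj b a) :
    HasCycleOfLength G (n + 1) := by
  obtain ⟨p, hp, -, rfl⟩ := h
  refine ⟨b, Walk.cons hba p, (Walk.cons_isCycle_iff p hba).2 ⟨hp, fun h => ?_⟩, by simp⟩
  -- A path that uses the edge between its own ends has length one.
  rw [Sym2.eq_swap] at h
  have := hp.length_eq_one_of_mem_edges h
  omega

theorem hasCycle_of_disjoint (h : PathIn G T a b n) (h' : PathIn G T' c d m)
    (hd : Disjoint T T') (hbc : G.Adj b c) (hda : G.Adj d a) (hnm : 1 ≤ n + m) :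
    HasCycleOfLength G (n + m + 2) :=
  (h.append_adj hbc h' hd).hasCycle (by omega) hda

end PathIn

theorem HasCycleOfLength.exists_path {m : ℕ} (h : HasCycleOfLength G m) :
    3 ≤ m ∧ ∃ a b, G.Adj b a ∧ PathIn G Set.univ a b (m - 1) := by
  obtain ⟨v, c, hc, rfl⟩ := h
  refine ⟨hc.three_le_length, ?_⟩
  cases c with
  | nil => simp at hc
  | @cons _ u _ h p =>
    exact ⟨u, v, h, p, ((Walk.cons_isCycle_iff p h).1 hc).1, by simp, by simp⟩

theorem HasCycleOfLength.map {W : Type*} {H : SimpleGraph W} (f : H ↪g G) {m : ℕ}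
    (h : HasCycleOfLength H m) : HasCycleOfLength G m := by
  obtain ⟨v, c, hc, rfl⟩ := h
  exact ⟨f v, c.map f.toHom, (Walk.isCycle_map_iff_of_injective f.injective).2 hc, by simp⟩

theorem hasCycle_of_list {a b : V} {l : List V} (hl : (a :: b :: l).Nodup) (hl' : l ≠ [])
    (hc : (a :: b :: l).IsChain G.Adj)
    (hla : G.Adj ((b :: l).getLast (by simp)) a) : HasCycleOfLength G (l.length + 2) := by
  have hp : ∀ (l : List V) (a : V), (a :: l).Nodup → (a :: l).IsChain G.Adj →
      PathIn G {v | v ∈ a :: l} a ((a :: l).getLast (by simp)) l.length := by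
    intro l
    induction l with
    | nil => exact fun a _ _ => PathIn.refl (by simp)
    | cons b l ih =>
      intro a hn hc
      rw [List.isChain_cons_cons] at hc
      rw [List.nodup_cons] at hn
      have := PathIn.cons hc.1 (by exact hn.1) (ih b hn.2 hc.2)
      rw [List.getLast_cons (by simp)]
      exact this.mono (by intro v; simp)
  have := hp _ _ hl hc
  rw [List.getLast_cons (by simp)] at this
  have hpos : 1 ≤ l.length := List.length_pos_of_ne_nil hl'
  exact this.hasCycle (by simp; omega) hla

theorem hasCycle_four {a b c d : V} (hn : [a, b, c, d].Nodup) (h₁ : G.Adj a b) (h₂ : G.Adj b c)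
    (h₃ : G.Adj c d) (h₄ : G.Adj d a) : HasCycleOfLength G 4 :=
  hasCycle_of_list hn (by simp) (by simp [*]) (by simpa using h₄)

theorem hasCycle_six {a b c d e f : V} (hn : [a, b, c, d, e, f].Nodup) (h₁ : G.Adj a b)
    (h₂ : G.Adj b c) (h₃ : G.Adj c d) (h₄ : G.Adj d e) (h₅ : G.Adj e f) (h₆ : G.Adj f a) :
    HasCycleOfLength G 6 :=
  hasCycle_of_list hn (by simp) (by simp [*]) (by simpa using h₆)

/-! ### Critical graphs and paths between root sets -/

/-- `G` has minimum degree at least three, no two adjacent vertices of degree three, and no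
vertex separates it. -/
structure Critical (G : SimpleGraph V) : Prop where
  degree : ∀ t u v, ∃ w, G.Adj t w ∧ w ≠ u ∧ w ≠ v
  cubic : ∀ t t', G.Adj t t' → (∀ u v, ∃ w, G.Adj t w ∧ w ≠ t' ∧ w ≠ u ∧ w ≠ v) ∨
    (∀ u v, ∃ w, G.Adj t' w ∧ w ≠ t ∧ w ≠ u ∧ w ≠ v)
  noCut : ∀ K : Set V, K.Nonempty → ∀ n ∉ K, (∃ v, v ∉ K ∧ v ≠ n) →
    ∃ k ∈ K, ∃ v, v ∉ K ∧ v ≠ n ∧ G.Adj k v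

/-- `T` is connected, its neighbours outside lie in the root sets `X` and `Y`, each vertex of `T`
has at most one neighbour in each of them, and both are adjacent to `T`. -/
structure Rooted (G : SimpleGraph V) (T X Y : Set V) : Prop where
  conn : ∀ a ∈ T, ∀ b ∈ T, LinkedIn G T a b
  notMemX : ∀ t ∈ T, t ∉ X
  notMemY : ∀ t ∈ T, t ∉ Y
  nbr : ∀ t ∈ T, ∀ v, G.Adj t v → v ∈ T ∨ v ∈ X ∨ v ∈ Y
  uniqX : ∀ t ∈ T, ∀ u ∈ X, ∀ v ∈ X, G.Adj t u → G.Adj t v → u = v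
  uniqY : ∀ t ∈ T, ∀ u ∈ Y, ∀ v ∈ Y, G.Adj t u → G.Adj t v → u = v
  adjX : ∃ t ∈ T, ∃ x ∈ X, G.Adj t x
  adjY : ∃ t ∈ T, ∃ y ∈ Y, G.Adj t y

/-- Two paths in `T` from neighbours of `X` to the same neighbour of `Y` whose lengths differ by
two. -/
def HasGap (G : SimpleGraph V) (T X Y : Set V) : Prop :=
  ∃ w₁ w₂ w n, (∃ x ∈ X, G.Adj w₁ x) ∧ (∃ x ∈ X, G.Adj w₂ x) ∧ (∃ y ∈ Y, G.Adj w y) ∧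
    PathIn G T w₁ w n ∧ PathIn G T w₂ w (n + 2)

namespace Rooted

variable {T X Y : Set V}

/-- The trivial path at `w` and the path `t₂, t₁, w` have lengths 0 and 2. -/
theorem hasGap_of_path_two (hr : ∀ t ∈ T, ∃ x ∈ X, G.Adj t x) {w t₁ t₂ y : V} (hw : w ∈ T)
    (h₁ : t₁ ∈ T) (h₂ : t₂ ∈ T) (hy : y ∈ Y) (hwy : G.Adj w y) (hw₁ : G.Adj w t₁)
    (h₁₂ : G.Adj t₁ t₂) (hne : t₂ ≠ w) : HasGap G T X Y := by
  refine ⟨w, t₂, w, 0, hr w hw, hr t₂ h₂, ⟨y, hy, hwy⟩, PathIn.refl hw, ?_⟩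
  have h := PathIn.cons h₁₂.symm (by simp [hne, h₁₂.ne']) (PathIn.single hw₁.symm)
  refine h.mono ?_
  rintro v (rfl | rfl | rfl) <;> assumption

/-- The case in which every vertex of `T` has a neighbour in `X`. -/
theorem hasGap_of_forall_adj (hG : Critical G) (h : Rooted G T X Y)
    (hr : ∀ t ∈ T, ∃ x ∈ X, G.Adj t x) : HasGap G T X Y := by
  obtain ⟨w, hw, y, hy, hwy⟩ := h.adjY
  obtain ⟨x, hx, hwx⟩ := hr w hw
  have other : ∀ v, G.Adj w v → v ≠ x → v ≠ y → v ∈ T := by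
    intro v hwv hvx hvy
    rcases h.nbr w hw v hwv with hv | hv | hv
    · exact hv
    · exact absurd (h.uniqX w hw v hv x hx hwv hwx) hvx
    · exact absurd (h.uniqY w hw v hv y hy hwv hwy) hvy
  obtain ⟨t, hwt, htx, hty⟩ := hG.degree w x y
  have ht := other t hwt htx hty
  obtain ⟨x', hx', htx'⟩ := hr t ht
  -- One of `w` and `t` has degree at least four. That supplies three vertices in a row in `T`, one
  -- end of which is adjacent to `Y`.
  rcases hG.cubic w t hwt with h3 | h3
  · obtain ⟨t₂, hwt₂, hne, h₂x, h₂y⟩ := h3 x y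
    have ht₂ := other t₂ hwt₂ h₂x h₂y
    obtain ⟨z, htz, hzw, hzx⟩ := hG.degree t w x'
    rcases h.nbr t ht z htz with hz | hz | hz
    · exact hasGap_of_path_two hr hw ht hz hy hwy hwt htz hzw
    · exact absurd (h.uniqX t ht z hz x' hx' htz htx') hzx
    · exact hasGap_of_path_two hr ht hw ht₂ hz htz hwt.symm hwt₂ hne
  · have : ∃ z, G.Adj t z ∧ z ≠ w ∧ z ∈ T := by
      by_cases hY : ∃ y' ∈ Y, G.Adj t y'
      · obtain ⟨y', hy', hty'⟩ := hY
        obtain ⟨z, htz, hzw, hzx, hzy⟩ := h3 x' y'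
        refine ⟨z, htz, hzw, ?_⟩
        rcases h.nbr t ht z htz with hz | hz | hz
        · exact hz
        · exact absurd (h.uniqX t ht z hz x' hx' htz htx') hzx
        · exact absurd (h.uniqY t ht z hz y' hy' htz hty') hzy
      · obtain ⟨z, htz, hzw, hzx, -⟩ := h3 x' x'
        refine ⟨z, htz, hzw, ?_⟩
        rcases h.nbr t ht z htz with hz | hz | hz
        · exact hz
        · exact absurd (h.uniqX t ht z hz x' hx' htz htx') hzx
        · exact absurd ⟨z, hz, htz⟩ hY
    obtain ⟨z, htz, hzw, hz⟩ := this
    exact hasGap_of_path_two hr hw ht hz hy hwy hwt htz hzw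

/-- A link that starts in `K`, where `B` contains `K` and its neighbours in `T`, leaves `B`
through a vertex outside `K`. -/
theorem exists_exit {K B : Set V} {a b : V} (h : LinkedIn G T a b) (ha : a ∈ B) (hb : b ∉ K)
    (hB : ∀ u ∈ K, ∀ v ∈ T, G.Adj u v → v ∈ B) :
    ∃ c ∈ B, c ∉ K ∧ c ∈ T ∧ LinkedIn G (T \ B ∪ {c}) c b := by
  obtain ⟨c, hcB, hcT, hc⟩ := h.exists_last ha
  refine ⟨c, hcB, fun hcK => hb ?_, hcT, hc⟩
  -- If `c` were in `K`, all its neighbours in `T` would lie in `B`, so the link could not leave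
  -- `c`.
  have : b ∈ ({c} : Set V) := by
    refine (hc.restrict (K := {c}) rfl ?_).right_mem
    rintro u rfl v (hv | hv) huv
    · exact absurd (hB u hcK v hv.1 huv) hv.2
    · exact hv
  rw [Set.mem_singleton_iff] at this
  exact this ▸ hcK

/-- The case in which a vertex of `T` without neighbours in `X` has two neighbours in `T` that
have neighbours in `X`. -/
theorem hasGap_of_two_adj (h : Rooted G T X Y) {t a b : V} (ht : t ∈ T)
    (htX : ∀ x ∈ X, ¬ G.Adj t x) (ha : a ∈ T) (haX : ∃ x ∈ X, G.Adj a x) (hta : G.Adj t a)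
    (hb : b ∈ T) (hbX : ∃ x ∈ X, G.Adj b x) (htb : G.Adj t b) (hab : a ≠ b)
    (ih : ∀ K X' Y' : Set V, K ⊂ T → Rooted G K X' Y' → HasGap G K X' Y') :
    HasGap G T X Y := by
  set B : Set V := {v | v ∈ T ∧ G.Adj t v ∧ ∃ x ∈ X, G.Adj v x} with hB
  have haB : a ∈ B := ⟨ha, hta, haX⟩
  have hbB : b ∈ B := ⟨hb, htb, hbX⟩
  by_cases hlink : ∃ w y, y ∈ Y ∧ G.Adj w y ∧ LinkedIn G (T \ {t}) a w
  · obtain ⟨w, y, hy, hwy, hl⟩ := hlink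
    -- From the last vertex `c` of `B` a path leads to `Y` without `t`. For any other `d ∈ B`, the
    -- start `d, t, c` makes it longer by two.
    obtain ⟨c, hcB, hcT, hc⟩ := hl.exists_last haB
    obtain ⟨d, hdB, hdc⟩ : ∃ d ∈ B, d ≠ c := by
      by_cases hac : a = c
      · exact ⟨b, hbB, fun h => hab (hac.trans h.symm)⟩
      · exact ⟨a, haB, hac⟩
    obtain ⟨n, hn⟩ := hc.exists_pathIn
    have ht' : t ∉ (T \ {t}) \ B ∪ {c} := by
      rintro (h | h)
      · exact h.1.2 rfl
      · exact hcT.2 h.symm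
    have hsub : (T \ {t}) \ B ∪ {c} ⊆ T := by
      rintro v (hv | rfl)
      exacts [hv.1.1, hcT.1]
    refine ⟨c, d, w, n, hcB.2.2, hdB.2.2, ⟨y, hy, hwy⟩, hn.mono hsub, ?_⟩
    refine ((hn.cons hcB.2.1 ht').cons hdB.2.1.symm ?_).mono ?_
    · rintro (h | h | h)
      · exact hdB.2.1.ne' h
      · exact h.2 hdB
      · exact hdc h
    · rintro v (rfl | rfl | hv)
      exacts [hdB.1, ht, hsub hv]
  -- The component of `a` in `T - t` is not adjacent to `Y`. There `t` replaces the root `Y`, and a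
  -- path from `t` to `Y` outside the component prolongs both paths.
  · push Not at hlink
    set K := comp G (T \ {t}) a with hK
    have haK : a ∈ K := LinkedIn.refl ⟨ha, hta.ne'⟩
    have hKT : K ⊆ T \ {t} := comp_subset
    have hroot : Rooted G K X {t} := by
      refine ⟨comp_connected, fun k hk => h.notMemX k (hKT hk).1, fun k hk => (hKT hk).2, ?_,
        fun k hk => h.uniqX k (hKT hk).1, ?_, ?_, ⟨a, haK, t, rfl, hta.symm⟩⟩
      · intro k hk v hkv
        rcases h.nbr k (hKT hk).1 v hkv with hv | hv | hv
        · by_cases hvt : v = t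
          · exact Or.inr (Or.inr hvt)
          · exact Or.inl (comp_closed k hk v ⟨hv, hvt⟩ hkv)
        · exact Or.inr (Or.inl hv)
        · exact absurd hk (hlink k v hv hkv)
      · rintro k hk u rfl v rfl - -
        rfl
      · obtain ⟨x, hx, hax⟩ := haX
        exact ⟨a, haK, x, hx, hax⟩
    obtain ⟨w₁, w₂, w, n, h₁, h₂, ⟨t', rfl, hwt⟩, hp₁, hp₂⟩ := ih K X {t}
      ⟨fun k hk => (hKT hk).1, fun hTK => (hKT (hTK ht)).2 rfl⟩ hroot
    obtain ⟨z, hz, y, hy, hzy⟩ := h.adjY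
    obtain ⟨c, hcB, hcK, -, hc⟩ := exists_exit (K := K) (B := insert t' K)
      (h.conn t' ht z hz) (Or.inl rfl) (fun hzK => hlink z y hy hzy hzK) (by
        intro u hu v hv huv
        by_cases hvt : v = t'
        · exact Or.inl hvt
        · exact Or.inr (comp_closed u hu v ⟨hv, hvt⟩ huv))
    obtain rfl : c = t' := hcB.resolve_right hcK
    obtain ⟨m, hm⟩ := hc.exists_pathIn
    have hd : Disjoint K (T \ insert c K ∪ {c}) := by
      rw [Set.disjoint_left]
      rintro v hv (hv' | rfl)
      · exact hv'.2 (Or.inr hv)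
      · exact hcK hv
    have hsub : K ∪ (T \ insert c K ∪ {c}) ⊆ T := by
      rintro v (hv | hv | rfl)
      exacts [(hKT hv).1, hv.1, ht]
    refine ⟨w₁, w₂, z, n + m + 1, h₁, h₂, ⟨y, hy, hzy⟩, (hp₁.append_adj hwt hm hd).mono hsub, ?_⟩
    convert (hp₂.append_adj hwt hm hd).mono hsub using 1
    omega

/-- The remaining case: `T` is reduced by contracting the neighbours of `X` in `T`. -/
theorem hasGap_of_subsingleton (hG : Critical G) (h : Rooted G T X Y) {t : V} (ht : t ∈ T)
    (htX : ∀ x ∈ X, ¬ G.Adj t x)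
    (huniq : ∀ s ∈ T, (∀ x ∈ X, ¬ G.Adj s x) → ∀ a ∈ T, (∃ x ∈ X, G.Adj a x) → ∀ b ∈ T,
      (∃ x ∈ X, G.Adj b x) → G.Adj s a → G.Adj s b → a = b)
    (ih : ∀ K X' Y' : Set V, K ⊂ T → Rooted G K X' Y' → HasGap G K X' Y') :
    HasGap G T X Y := by
  set N : Set V := {v | v ∈ T ∧ ∃ x ∈ X, G.Adj v x} with hN
  set K := comp G (T \ N) t with hK
  have htN : t ∉ N := fun ⟨_, x, hx, htx⟩ => htX x hx htx
  have htK : t ∈ K := LinkedIn.refl ⟨ht, htN⟩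
  have hKT : K ⊆ T \ N := comp_subset
  have hKX : ∀ k ∈ K, ∀ x ∈ X, ¬ G.Adj k x := fun k hk x hx hkx =>
    (hKT hk).2 ⟨(hKT hk).1, x, hx, hkx⟩
  have hclosed : ∀ u ∈ K, ∀ v ∈ T, G.Adj u v → v ∈ K ∨ v ∈ N := by
    intro u hu v hv huv
    by_cases hvN : v ∈ N
    · exact Or.inr hvN
    · exact Or.inl (comp_closed u hu v ⟨hv, hvN⟩ huv)
  have hss : K ⊂ T := by
    refine ⟨fun k hk => (hKT hk).1, fun hTK => ?_⟩
    obtain ⟨s, hs, x, hx, hsx⟩ := h.adjX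
    exact (hKT (hTK hs)).2 ⟨hs, x, hx, hsx⟩
  -- If `K` is adjacent to `Y`, the set `N` takes the place of `X`, and one step into `N` is put
  -- before both paths.
  by_cases hadj : ∃ k ∈ K, ∃ y ∈ Y, G.Adj k y
  · have hroot : Rooted G K N Y := by
      refine ⟨comp_connected, fun k hk => (hKT hk).2, fun k hk => h.notMemY k (hKT hk).1, ?_, ?_,
        fun k hk => h.uniqY k (hKT hk).1, ?_, hadj⟩
      · intro k hk v hkv
        rcases h.nbr k (hKT hk).1 v hkv with hv | hv | hv
        · exact (hclosed k hk v hv hkv).imp_right Or.inl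
        · exact absurd hkv (hKX k hk v hv)
        · exact Or.inr (Or.inr hv)
      · intro k hk u hu v hv hku hkv
        exact huniq k (hKT hk).1 (hKX k hk) u hu.1 hu.2 v hv.1 hv.2 hku hkv
      · obtain ⟨s, hs, x, hx, hsx⟩ := h.adjX
        obtain ⟨u, hu, v, hv, -, hvT, huv⟩ := (h.conn t ht s hs).exists_adj_of_mem_of_notMem htK
          (fun hsK => (hKT hsK).2 ⟨hs, x, hx, hsx⟩)
        exact ⟨u, hu, v, (hclosed u hu v hvT huv).resolve_left hv, huv⟩
    obtain ⟨w₁, w₂, w, n, ⟨x₁, hx₁, h₁⟩, ⟨x₂, hx₂, h₂⟩, hy, hp₁, hp₂⟩ := ih K N Y hss hroot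
    have hsub : ∀ x ∈ N, insert x K ⊆ T := by
      rintro x hx v (rfl | hv)
      exacts [hx.1, (hKT hv).1]
    exact ⟨x₁, x₂, w, n + 1, hx₁.2, hx₂.2, hy,
      (hp₁.cons h₁.symm fun hx => (hKT hx).2 hx₁).mono (hsub _ hx₁),
      (hp₂.cons h₂.symm fun hx => (hKT hx).2 hx₂).mono (hsub _ hx₂)⟩
  · push Not at hadj
    -- Here `K` is adjacent only to `M ⊆ N`. A vertex `m ∈ M` from which `Y` is reached outside `K ∪
    -- M` serves as one root, and the rest of `M` as the other.
    set M : Set V := {v | v ∈ T ∧ v ∉ K ∧ ∃ k ∈ K, G.Adj k v} with hM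
    have hMN : M ⊆ N := fun v ⟨hvT, hvK, k, hk, hkv⟩ =>
      (hclosed k hk v hvT hkv).resolve_left hvK
    obtain ⟨z, hz, y, hy, hzy⟩ := h.adjY
    obtain ⟨m, hmB, hmK, hmT, hm⟩ := exists_exit (K := K) (B := K ∪ M)
      (h.conn t ht z hz) (Or.inl htK) (fun hzK => hadj z hzK y hy hzy) (by
        intro u hu v hv huv
        by_cases hvK : v ∈ K
        · exact Or.inl hvK
        · exact Or.inr ⟨hv, hvK, u, hu, huv⟩)
    have hmM : m ∈ M := hmB.resolve_left hmK
    have hroot : Rooted G K (M \ {m}) {m} := by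
      refine ⟨comp_connected, fun k hk hkM => hkM.1.2.1 hk, ?_, ?_, ?_, ?_, ?_, ?_⟩
      · rintro k hk rfl
        exact hmK hk
      · intro k hk v hkv
        rcases h.nbr k (hKT hk).1 v hkv with hv | hv | hv
        · by_cases hvK : v ∈ K
          · exact Or.inl hvK
          · by_cases hvm : v = m
            · exact Or.inr (Or.inr hvm)
            · exact Or.inr (Or.inl ⟨⟨hv, hvK, k, hk, hkv⟩, hvm⟩)
        · exact absurd hkv (hKX k hk v hv)
        · exact absurd hkv (hadj k hk v hv)
      · intro k hk u hu v hv hku hkv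
        exact huniq k (hKT hk).1 (hKX k hk) u (hMN hu.1).1 (hMN hu.1).2 v (hMN hv.1).1
          (hMN hv.1).2 hku hkv
      · rintro k hk u rfl v rfl - -
        rfl
      -- `m` alone does not separate `K` from `Y`, so `M \ {m}` is not empty.
      · obtain ⟨k, hk, v, hvK, hvm, hkv⟩ := hG.noCut K ⟨t, htK⟩ m hmK
          ⟨y, fun hyK => h.notMemY y (hKT hyK).1 hy, fun hym => h.notMemY m hmT (hym ▸ hy)⟩
        refine ⟨k, hk, v, ⟨⟨?_, hvK, k, hk, hkv⟩, hvm⟩, hkv⟩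
        rcases h.nbr k (hKT hk).1 v hkv with hv | hv | hv
        · exact hv
        · exact absurd hkv (hKX k hk v hv)
        · exact absurd hkv (hadj k hk v hv)
      · obtain ⟨-, -, k, hk, hkm⟩ := hmM
        exact ⟨k, hk, m, rfl, hkm⟩
    obtain ⟨w₁, w₂, w, n, ⟨x₁, hx₁, h₁⟩, ⟨x₂, hx₂, h₂⟩, ⟨m', rfl, hwm⟩, hp₁, hp₂⟩ :=
      ih K _ _ hss hroot
    obtain ⟨l, hl⟩ := hm.exists_pathIn
    have hd : Disjoint K (T \ (K ∪ M) ∪ {m'}) := by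
      rw [Set.disjoint_left]
      rintro v hv (hv' | rfl)
      · exact hv'.2 (Or.inl hv)
      · exact hmK hv
    have hnot : ∀ x ∈ M \ {m'}, x ∉ K ∪ (T \ (K ∪ M) ∪ {m'}) := by
      rintro x hx (hv | hv | hv)
      · exact hx.1.2.1 hv
      · exact hv.2 (Or.inr hx.1)
      · exact hx.2 hv
    have hsub : ∀ x ∈ M \ {m'}, insert x (K ∪ (T \ (K ∪ M) ∪ {m'})) ⊆ T := by
      rintro x hx v (rfl | hv | hv | rfl)
      exacts [hx.1.1, (hKT hv).1, hv.1, hmT]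
    refine ⟨x₁, x₂, z, n + l + 1 + 1, (hMN hx₁.1).2, (hMN hx₂.1).2, ⟨y, hy, hzy⟩,
      ((hp₁.append_adj hwm hl hd).cons h₁.symm (hnot _ hx₁)).mono (hsub _ hx₁), ?_⟩
    convert ((hp₂.append_adj hwm hl hd).cons h₂.symm (hnot _ hx₂)).mono (hsub _ hx₂) using 1
    omega

/-- Induction on the size of `T`. The three cases are exhaustive: every vertex of `T` sees `X`, or
some vertex that does not has two neighbours that do, or each such vertex has at most one. -/
theorem hasGap [Finite V] (hG : Critical G) (h : Rooted G T X Y) : HasGap G T X Y := by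
  induction hc : T.ncard using Nat.strong_induction_on generalizing T X Y with
  | _ c ih =>
    subst hc
    have ih' : ∀ K X' Y' : Set V, K ⊂ T → Rooted G K X' Y' → HasGap G K X' Y' :=
      fun K X' Y' hK hr => ih _ (Set.ncard_lt_ncard hK) hr rfl
    by_cases hr : ∀ t ∈ T, ∃ x ∈ X, G.Adj t x
    · exact h.hasGap_of_forall_adj hG hr
    · push Not at hr
      obtain ⟨t, ht, htX⟩ := hr
      by_cases huniq : ∀ s ∈ T, (∀ x ∈ X, ¬ G.Adj s x) → ∀ a ∈ T, (∃ x ∈ X, G.Adj a x) →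
          ∀ b ∈ T, (∃ x ∈ X, G.Adj b x) → G.Adj s a → G.Adj s b → a = b
      · exact h.hasGap_of_subsingleton hG ht htX huniq ih'
      · push Not at huniq
        obtain ⟨s, hs, hsX, a, ha, haX, b, hb, hbX, hsa, hsb, hab⟩ := huniq
        exact h.hasGap_of_two_adj hs hsX ha haX hsa hb hbX hsb hab ih'

end Rooted

/-! ### Flexible sets -/

/-- Any two vertices of `S` are joined within `S` by paths of both parities. -/
def Flexible (G : SimpleGraph V) (S : Set V) : Prop :=
  ∀ u ∈ S, ∀ v ∈ S, u ≠ v → ∃ m n, Even m ∧ Odd n ∧ PathIn G S u v m ∧ PathIn G S u v n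

/-- `Rooted.hasGap` is applied to the component of `d` with roots `{u}` and `S \ {u}`. The second
root set is attached because `u` is no cut-vertex. The offset `n` does not depend on the path in `S`
that closes the cycles. -/
theorem exists_cycles_through [Finite V] (hG : Critical G) {S : Set V} {u d : V} (huS : u ∈ S)
    (hS : ∃ s ∈ S, s ≠ u) (hu : ∃ z ∈ comp G Sᶜ d, G.Adj z u)
    (huniq : ∀ z ∈ comp G Sᶜ d, ∀ p ∈ S, ∀ q ∈ S, p ≠ u → q ≠ u → G.Adj z p → G.Adj z q → p = q) :
    ∃ y ∈ S, y ≠ u ∧ ∃ n, ∀ m, PathIn G S y u m →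
      HasCycleOfLength G (n + m) ∧ HasCycleOfLength G (n + m + 2) := by
  set D := comp G Sᶜ d with hD
  have hDS : ∀ z ∈ D, z ∉ S := fun z hz => comp_subset hz
  have hclosed : ∀ z ∈ D, ∀ v, v ∉ D → G.Adj z v → v ∈ S := by
    intro z hz v hv hzv
    by_contra hvS
    exact hv (comp_closed z hz v hvS hzv)
  have hroot : Rooted G D {u} (S \ {u}) := by
    refine ⟨comp_connected, ?_, fun t ht h => hDS t ht h.1, ?_, ?_, ?_, ?_, ?_⟩
    · rintro t ht rfl
      exact hDS t ht huS
    · intro t ht v htv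
      by_cases hvD : v ∈ D
      · exact Or.inl hvD
      · by_cases hvu : v = u
        · exact Or.inr (Or.inl hvu)
        · exact Or.inr (Or.inr ⟨hclosed t ht v hvD htv, hvu⟩)
    · rintro t ht p rfl q rfl - -
      rfl
    · intro t ht p hp q hq htp htq
      exact huniq t ht p hp.1 q hq.1 hp.2 hq.2 htp htq
    · obtain ⟨z, hz, hzu⟩ := hu
      exact ⟨z, hz, u, rfl, hzu⟩
    · obtain ⟨s, hs, hsu⟩ := hS
      obtain ⟨z, hz, -⟩ := hu
      obtain ⟨k, hk, v, hv, hvu, hkv⟩ := hG.noCut D ⟨z, hz⟩ u (fun h => hDS u h huS)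
        ⟨s, fun h => hDS s h hs, hsu⟩
      exact ⟨k, hk, v, ⟨hclosed k hk v hv hkv, hvu⟩, hkv⟩
  obtain ⟨w₁, w₂, w, n, ⟨x₁, rfl, h₁⟩, ⟨x₂, rfl, h₂⟩, ⟨y, hy, hwy⟩, hp₁, hp₂⟩ := hroot.hasGap hG
  have hd : Disjoint D S := Set.disjoint_left.2 hDS
  refine ⟨y, hy.1, hy.2, n + 2, fun m hm => ?_⟩
  have hm1 := hm.pos_of_ne hy.2
  constructor
  · convert hp₁.hasCycle_of_disjoint hm hd hwy h₁.symm (by omega) using 1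
    omega
  · exact hp₂.hasCycle_of_disjoint hm hd hwy h₂.symm (by omega)

theorem Flexible.hasTwoConsecutiveEvenCycles [Finite V] (hG : Critical G) {S : Set V}
    (hF : Flexible G S) {u d : V} (huS : u ∈ S)
    (hS : ∃ s ∈ S, s ≠ u) (hu : ∃ z ∈ comp G Sᶜ d, G.Adj z u)
    (huniq : ∀ z ∈ comp G Sᶜ d, ∀ p ∈ S, ∀ q ∈ S, p ≠ u → q ≠ u → G.Adj z p → G.Adj z q → p = q) :
    HasTwoConsecutiveEvenCycles G := by
  obtain ⟨y, hy, hyu, n, hn⟩ := exists_cycles_through hG huS hS hu huniq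
  obtain ⟨m, m', hm, hm', hp, hp'⟩ := hF y hy u huS hyu
  rcases Nat.even_or_odd n with h | h
  · exact ⟨n + m, h.add hm, hn m hp⟩
  · exact ⟨n + m', h.add_odd hm', hn m' hp'⟩

/-- A component of the complement of `S` is adjacent to `S`. -/
theorem Critical.exists_adj_comp (hG : Critical G) {S : Set V} {d s s' : V} (hs : s ∈ S)
    (hs' : s' ∈ S) (hss' : s ≠ s') (hd : d ∉ S) : ∃ u ∈ S, ∃ z ∈ comp G Sᶜ d, G.Adj z u := by
  have hdD : d ∈ comp G Sᶜ d := LinkedIn.refl hd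
  have hDS : ∀ z ∈ comp G Sᶜ d, z ∉ S := fun z hz => comp_subset hz
  obtain ⟨k, hk, v, hv, -, hkv⟩ := hG.noCut (comp G Sᶜ d) ⟨d, hdD⟩ s (fun h => hDS s h hs)
    ⟨s', fun h => hDS s' h hs', hss'.symm⟩
  refine ⟨v, ?_, k, hk, hkv⟩
  by_contra hvS
  exact hv (comp_closed k hk v hvS hkv)

/-- A vertex joined to all of `R` is flexible together with `R` if `R` induces a graph without
isolated vertices. -/
theorem flexible_insert {a : V} {R : Set V} (haR : ∀ r ∈ R, G.Adj a r)
    (hR : ∀ r ∈ R, ∃ r' ∈ R, G.Adj r r') : Flexible G (insert a R) := by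
  have hub : ∀ v ∈ R, PathIn G (insert a R) a v 1 ∧ PathIn G (insert a R) a v 2 := by
    intro v hv
    obtain ⟨r, hr, hvr⟩ := hR v hv
    refine ⟨(PathIn.single (haR v hv)).mono ?_,
      ((PathIn.single hvr.symm).cons (haR r hr) ?_).mono ?_⟩
    · rintro x (rfl | rfl)
      exacts [Or.inl rfl, Or.inr hv]
    · simp [(haR r hr).ne, (haR v hv).ne]
    · rintro x (rfl | rfl | rfl)
      exacts [Or.inl rfl, Or.inr hr, Or.inr hv]
  have rim : ∀ u ∈ R, ∀ v ∈ R, u ≠ v →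
      PathIn G (insert a R) u v 2 ∧ ∃ n, Odd n ∧ PathIn G (insert a R) u v n := by
    intro u hu v hv huv
    have h₂ := (PathIn.single (haR v hv)).cons (haR u hu).symm (by simp [huv, (haR u hu).ne'])
    refine ⟨h₂.mono ?_, ?_⟩
    · rintro x (rfl | rfl | rfl)
      exacts [Or.inr hu, Or.inl rfl, Or.inr hv]
    · by_cases hadj : G.Adj u v
      · refine ⟨1, odd_one, (PathIn.single hadj).mono ?_⟩
        rintro x (rfl | rfl)
        exacts [Or.inr hu, Or.inr hv]
      · obtain ⟨r, hr, hur⟩ := hR u hu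
        have hrv : r ≠ v := fun h => hadj (h ▸ hur)
        have h₃ := ((PathIn.single (haR v hv)).cons (haR r hr).symm
          (by simp [hrv, (haR r hr).ne'])).cons hur (by simp [huv, hur.ne, (haR u hu).ne'])
        refine ⟨3, by decide, h₃.mono ?_⟩
        rintro x (rfl | rfl | rfl | rfl)
        exacts [Or.inr hu, Or.inr hr, Or.inl rfl, Or.inr hv]
  rintro u (rfl | hu) v (rfl | hv) huv
  · exact absurd rfl huv
  · exact ⟨2, 1, even_two, odd_one, (hub v hv).2, (hub v hv).1⟩
  · exact ⟨2, 1, even_two, odd_one, (hub u hu).2.symm, (hub u hu).1.symm⟩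
  · obtain ⟨h₂, n, hn, h⟩ := rim u hu v hv huv
    exact ⟨2, n, even_two, hn, h₂, h⟩

/-! ### Fans and diamonds -/

/-- The fan with hub `a` and rim `t, c, b, d`. -/
structure IsFan (G : SimpleGraph V) (a t c b d : V) : Prop where
  at' : G.Adj a t
  ac : G.Adj a c
  ab : G.Adj a b
  ad : G.Adj a d
  tc : G.Adj t c
  cb : G.Adj c b
  bd : G.Adj b d
  tb_ne : t ≠ b
  td_ne : t ≠ d
  cd_ne : c ≠ d

/-- The fan is flexible and has a 4-cycle, so a 6-cycle may be excluded. A vertex outside with two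
neighbours on the rim would close one, as every two rim vertices are joined by a path of length four
in the fan. Hence `u` can be the hub, or any attachment if the component avoids the hub. -/
theorem IsFan.hasTwoConsecutiveEvenCycles [Finite V] (hG : Critical G) {a t c b d o : V}
    (h : IsFan G a t c b d) (ho : o ∉ ({a, t, c, b, d} : Set V)) :
    HasTwoConsecutiveEvenCycles G := by
  by_contra hP
  obtain ⟨hat, hac, hab, had, htc, hcb, hbd, htb, htd, hcd⟩ := h
  have hat' := hat.ne; have hac' := hac.ne; have hab' := hab.ne; have had' := had.ne
  have htc' := htc.ne; have hcb' := hcb.ne; have hbd' := hbd.ne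
  have h4 : HasCycleOfLength G 4 :=
    hasCycle_four (a := a) (b := t) (c := c) (d := b) (by simp [*]) hat htc hcb hab.symm
  have h6 : ¬ HasCycleOfLength G 6 := fun h => hP ⟨4, by decide, h4, h⟩
  have hflex : Flexible G ({a, t, c, b, d} : Set V) := by
    refine flexible_insert ?_ ?_
    · rintro r (rfl | rfl | rfl | rfl) <;> assumption
    · rintro r (rfl | rfl | rfl | rfl)
      exacts [⟨c, by simp, htc⟩, ⟨t, by simp, htc.symm⟩, ⟨d, by simp, hbd⟩, ⟨b, by simp, hbd.symm⟩]
  set S : Set V := {a, t, c, b, d} with hS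
  have huniq : ∀ z ∉ S, ∀ p ∈ S, ∀ q ∈ S, p ≠ a → q ≠ a → G.Adj z p → G.Adj z q → p = q := by
    intro z hz
    obtain ⟨hza, hzt, hzc, hzb, hzd⟩ : z ≠ a ∧ z ≠ t ∧ z ≠ c ∧ z ≠ b ∧ z ≠ d := by
      simpa [hS] using hz
    have tc : G.Adj z t → G.Adj z c → False := fun h h' => h6 <|
      hasCycle_six (a := z) (b := t) (c := a) (d := d) (e := b) (f := c)
        (by simp; grind) h hat.symm had hbd.symm hcb.symm h'.symm
    have tb : G.Adj z t → G.Adj z b → False := fun h h' => h6 <|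
      hasCycle_six (a := z) (b := t) (c := c) (d := a) (e := d) (f := b)
        (by simp; grind) h htc hac.symm had hbd.symm h'.symm
    have td : G.Adj z t → G.Adj z d → False := fun h h' => h6 <|
      hasCycle_six (a := z) (b := t) (c := c) (d := a) (e := b) (f := d)
        (by simp; grind) h htc hac.symm hab hbd h'.symm
    have cb : G.Adj z c → G.Adj z b → False := fun h h' => h6 <|
      hasCycle_six (a := z) (b := c) (c := t) (d := a) (e := d) (f := b)
        (by simp; grind) h htc.symm hat.symm had hbd.symm h'.symm
    have cd : G.Adj z c → G.Adj z d → False := fun h h' => h6 <|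
      hasCycle_six (a := z) (b := c) (c := t) (d := a) (e := b) (f := d)
        (by simp; grind) h htc.symm hat.symm hab hbd h'.symm
    have bd : G.Adj z b → G.Adj z d → False := fun h h' => h6 <|
      hasCycle_six (a := z) (b := b) (c := c) (d := t) (e := a) (f := d)
        (by simp; grind) h hcb.symm htc.symm hat.symm had h'.symm
    rintro p (rfl | rfl | rfl | rfl | rfl) q (rfl | rfl | rfl | rfl | rfl) hp hq h h' <;>
      first
      | rfl
      | exact absurd rfl hp
      | exact absurd rfl hq
      | exact (tc h h').elim
      | exact (tc h' h).elim
      | exact (tb h h').elim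
      | exact (tb h' h).elim
      | exact (td h h').elim
      | exact (td h' h).elim
      | exact (cb h h').elim
      | exact (cb h' h).elim
      | exact (cd h h').elim
      | exact (cd h' h).elim
      | exact (bd h h').elim
      | exact (bd h' h).elim
  have hDS : ∀ z ∈ comp G Sᶜ o, z ∉ S := fun z hz => comp_subset hz
  by_cases hD : ∃ z ∈ comp G Sᶜ o, G.Adj z a
  · exact hP (hflex.hasTwoConsecutiveEvenCycles hG (u := a) (d := o) (by simp [hS])
      ⟨t, by simp [hS], hat.ne'⟩ hD fun z hz => huniq z (hDS z hz))
  · obtain ⟨u, hu, z, hz, hzu⟩ := hG.exists_adj_comp (S := S) (s := a) (s' := t) (by simp [hS])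
      (by simp [hS]) hat.ne ho
    refine hP (hflex.hasTwoConsecutiveEvenCycles hG (u := u) (d := o) hu
      ⟨a, by simp [hS], fun h => hD ⟨z, hz, h ▸ hzu⟩⟩ ⟨z, hz, hzu⟩ ?_)
    rintro z hz p hp q hq - - hzp hzq
    exact huniq z (hDS z hz) p hp q hq (fun h => hD ⟨z, hz, h ▸ hzp⟩)
      (fun h => hD ⟨z, hz, h ▸ hzq⟩) hzp hzq

/-- Two triangles `a b c` and `a b d` with a common edge. -/
structure IsDiamond (G : SimpleGraph V) (a b c d : V) : Prop where
  ab : G.Adj a b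
  ac : G.Adj a c
  ad : G.Adj a d
  bc : G.Adj b c
  bd : G.Adj b d
  cd_ne : c ≠ d

theorem IsDiamond.symm {a b c d : V} (h : IsDiamond G a b c d) : IsDiamond G b a c d :=
  ⟨h.ab.symm, h.bc, h.bd, h.ac, h.ad, h.cd_ne⟩

theorem IsDiamond.swap {a b c d : V} (h : IsDiamond G a b c d) : IsDiamond G a b d c :=
  ⟨h.ab, h.ad, h.ac, h.bd, h.bc, h.cd_ne.symm⟩

theorem IsDiamond.hasTwoConsecutiveEvenCycles [Finite V] (hG : Critical G)
    (hV : ∀ s : Finset V, s.card ≤ 5 → ∃ v, v ∉ s) {a b c d : V} (h : IsDiamond G a b c d) :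
    HasTwoConsecutiveEvenCycles G := by
  classical
  by_contra hP
  have nofan : ∀ a t c b d, ¬ IsFan G a t c b d := by
    intro a t c b d hf
    obtain ⟨o, ho⟩ := hV {a, t, c, b, d} Finset.card_le_five
    exact hP (hf.hasTwoConsecutiveEvenCycles hG (o := o) (by simpa using ho))
  -- a vertex outside a diamond is not adjacent to both ends of one of its outer edges
  have outer : ∀ {a b c d}, IsDiamond G a b c d → ∀ z, z ≠ b → z ≠ d →
      G.Adj z a → G.Adj z c → False := fun {a b c d} h z hzb hzd hza hzc =>
    nofan a z c b d ⟨hza.symm, h.ac, h.ab, h.ad, hzc, h.bc.symm, h.bd, hzb, hzd, h.cd_ne⟩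
  obtain ⟨o, ho⟩ := hV {a, b, c, d} (Finset.card_le_four.trans (by norm_num))
  have hflex : Flexible G ({a, b, c, d} : Set V) := by
    refine flexible_insert ?_ ?_
    · rintro r (rfl | rfl | rfl)
      exacts [h.ab, h.ac, h.ad]
    · rintro r (rfl | rfl | rfl)
      exacts [⟨c, by simp, h.bc⟩, ⟨b, by simp, h.bc.symm⟩, ⟨b, by simp, h.bd.symm⟩]
  set S : Set V := {a, b, c, d} with hS
  have hoS : o ∉ S := by simpa [hS] using ho
  have hDS : ∀ z ∈ comp G Sᶜ o, z ≠ a ∧ z ≠ b ∧ z ≠ c ∧ z ≠ d := by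
    intro z hz
    have : z ∉ S := comp_subset hz
    simpa [hS] using this
  have hab := h.ab.ne; have hac := h.ac.ne; have had := h.ad.ne
  have hbc := h.bc.ne; have hbd := h.bd.ne; have hcd := h.cd_ne
  -- No fan exists, so two neighbours in `S` of an outside vertex are the pair `a, b` or the pair
  -- `c, d`.
  have huniq : ∀ z ∈ comp G Sᶜ o, ∀ p ∈ S, ∀ q ∈ S, G.Adj z p → G.Adj z q →
      p = q ∨ (G.Adj z a ∧ G.Adj z b ∧ (p = a ∨ p = b) ∧ (q = a ∨ q = b)) ∨
      (G.Adj z c ∧ G.Adj z d ∧ (p = c ∨ p = d) ∧ (q = c ∨ q = d)) := by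
    intro z hz p hp q hq hzp hzq
    obtain ⟨hza, hzb, hzc, hzd⟩ := hDS z hz
    have h1 := outer h z hzb hzd
    have h2 := outer h.swap z hzb hzc
    have h3 := outer h.symm z hza hzd
    have h4 := outer h.symm.swap z hza hzc
    simp only [hS, Set.mem_insert_iff, Set.mem_singleton_iff] at hp hq
    clear hflex hDS outer nofan hoS ho hV
    rcases hp with hp | hp | hp | hp <;> rcases hq with hq | hq | hq | hq <;>
      rw [hp] at hzp ⊢ <;> rw [hq] at hzq ⊢ <;> tauto
  -- A vertex seeing `c, d` and another seeing `a, b` give a 6-cycle next to the 4-cycle of the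
  -- diamond. So only one kind of pair occurs, and a suitable `u` in that pair destroys it.
  by_cases hzcd : ∃ z ∈ comp G Sᶜ o, G.Adj z c ∧ G.Adj z d
  · obtain ⟨z, hz, hzc, hzd⟩ := hzcd
    refine hP (hflex.hasTwoConsecutiveEvenCycles hG (u := c) (d := o) (by simp [hS])
      ⟨a, by simp [hS], hac⟩ ⟨z, hz, hzc⟩ ?_)
    intro z' hz' p hp q hq hpc hqc hzp hzq
    rcases huniq z' hz' p hp q hq hzp hzq with h' | ⟨hza', hzb', -⟩ | ⟨-, -, h1, h2⟩
    · exact h'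
    · have hne : z ≠ z' := by
        rintro rfl
        exact outer h z (hDS z hz).2.1 (hDS z hz).2.2.2 hza' hzc
      obtain ⟨hz1, hz2, hz3, hz4⟩ := hDS z hz
      obtain ⟨hz1', hz2', hz3', hz4'⟩ := hDS z' hz'
      refine (hP ⟨4, by decide, ?_, ?_⟩).elim
      · exact hasCycle_four (a := a) (b := c) (c := b) (d := d) (by simp [*]; grind) h.ac
          h.bc.symm h.bd h.ad.symm
      · exact hasCycle_six (a := c) (b := a) (c := z') (d := b) (e := d) (f := z)
          (by simp; grind) h.ac.symm hza'.symm hzb' h.bd hzd.symm hzc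
    · rw [h1.resolve_left hpc, h2.resolve_left hqc]
  · have main : ∀ u, u = a ∨ u = b → ¬ ∃ z ∈ comp G Sᶜ o, G.Adj z u := by
      intro u hu hD
      refine hP (hflex.hasTwoConsecutiveEvenCycles hG (u := u) (d := o) ?_ ⟨c, by simp [hS], ?_⟩
        hD ?_)
      · rcases hu with rfl | rfl <;> simp [hS]
      · rcases hu with rfl | rfl
        exacts [hac.symm, hbc.symm]
      · intro z hz p hp q hq hpu hqu hzp hzq
        rcases huniq z hz p hp q hq hzp hzq with h' | ⟨-, -, h1, h2⟩ | ⟨hc, hd, -⟩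
        · exact h'
        · rcases hu with rfl | rfl
          · rw [h1.resolve_left hpu, h2.resolve_left hqu]
          · rw [h1.resolve_right hpu, h2.resolve_right hqu]
        · exact absurd ⟨z, hz, hc, hd⟩ hzcd
    obtain ⟨u, hu, z, hz, hzu⟩ := hG.exists_adj_comp (S := S) (s := a) (s' := b) (by simp [hS])
      (by simp [hS]) hab hoS
    refine hP (hflex.hasTwoConsecutiveEvenCycles hG (u := u) (d := o) hu
      ⟨a, by simp [hS], ?_⟩ ⟨z, hz, hzu⟩ ?_)
    · rintro rfl
      exact main _ (Or.inl rfl) ⟨z, hz, hzu⟩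
    · intro z hz p hp q hq hpu hqu hzp hzq
      rcases huniq z hz p hp q hq hzp hzq with h' | ⟨ha, -⟩ | ⟨hc, hd, -⟩
      · exact h'
      · exact absurd ⟨z, hz, ha⟩ (main a (Or.inl rfl))
      · exact absurd ⟨z, hz, hc, hd⟩ hzcd

/-! ### Shortest odd cycles -/

theorem pathIn_of_seq {f : ℕ → V} {i d : ℕ}
    (hinj : ∀ j k, i ≤ j → j ≤ k → k ≤ i + d → f j = f k → j = k)
    (hadj : ∀ j, G.Adj (f j) (f (j + 1))) :
    PathIn G (f '' Set.Icc i (i + d)) (f i) (f (i + d)) d := by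
  induction d with
  | zero => exact PathIn.refl ⟨i, by simp, rfl⟩
  | succ d ih =>
    have h := (ih fun j k h₁ h₂ h₃ => hinj j k h₁ h₂ (by omega)).append_adj (hadj (i + d))
      (PathIn.refl (T := {f (i + d + 1)}) rfl) ?_
    · refine h.mono ?_
      rintro v (⟨j, hj, rfl⟩ | rfl)
      · exact ⟨j, ⟨hj.1, by have := hj.2; omega⟩, rfl⟩
      · exact ⟨i + d + 1, ⟨by omega, by omega⟩, rfl⟩
    · rw [Set.disjoint_singleton_right]
      rintro ⟨j, hj, hji⟩
      have h1 := hj.1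
      have h2 := hj.2
      have := hinj j (i + d + 1) h1 (by omega) (by omega) hji
      omega

/-- The periodic sequence `f` runs around a cycle of length `L`. -/
structure RunsAround (G : SimpleGraph V) (L : ℕ) (f : ℕ → V) : Prop where
  three_le : 3 ≤ L
  inj : ∀ i j, f i = f j ↔ i ≡ j [MOD L]
  adj : ∀ i, G.Adj (f i) (f (i + 1))

theorem HasCycleOfLength.exists_runsAround {L : ℕ} (h : HasCycleOfLength G L) :
    ∃ f, RunsAround G L f := by
  obtain ⟨v, c, hc, rfl⟩ := h
  have h3 := hc.three_le_length
  refine ⟨fun i => c.getVert (i % c.length), h3, fun i j => ⟨fun h => ?_, fun h => ?_⟩, fun i => ?_⟩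
  · have hi := Nat.mod_lt i (by omega : 0 < c.length)
    have hj := Nat.mod_lt j (by omega : 0 < c.length)
    exact hc.getVert_injOn' (by simp only [Set.mem_ofPred_eq]; omega)
      (by simp only [Set.mem_ofPred_eq]; omega) h
  · exact congrArg c.getVert h
  · have hi := Nat.mod_lt i (by omega : 0 < c.length)
    have hadj := c.adj_getVert_succ hi
    by_cases h : i % c.length + 1 < c.length
    · have : (i + 1) % c.length = i % c.length + 1 := by
        rw [Nat.add_mod, Nat.mod_eq_of_lt (by omega : 1 < c.length), Nat.mod_eq_of_lt h]
      simpa only [this] using hadj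
    · have h' : i % c.length + 1 = c.length := by omega
      have : (i + 1) % c.length = 0 := by
        rw [Nat.add_mod, Nat.mod_eq_of_lt (by omega : 1 < c.length), h', Nat.mod_self]
      simp only [this, Walk.getVert_zero]
      rwa [h', Walk.getVert_length] at hadj

namespace RunsAround

variable {L : ℕ} {f : ℕ → V}

theorem add_period (h : RunsAround G L f) (i : ℕ) : f (i + L) = f i :=
  (h.inj _ _).2 (by simp [Nat.ModEq])

theorem eq_of_lt (h : RunsAround G L f) {i j : ℕ} (hij : i ≤ j) (hj : j < i + L)
    (hf : f i = f j) : i = j := by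
  have hd := (Nat.modEq_iff_dvd' hij).1 ((h.inj i j).1 hf)
  have := Nat.eq_zero_of_dvd_of_lt hd (by omega)
  omega

theorem arc (h : RunsAround G L f) (i : ℕ) {d : ℕ} (hd : d < L) :
    PathIn G (Set.range f) (f i) (f (i + d)) d :=
  (pathIn_of_seq (fun j k _ h₂ _ => h.eq_of_lt h₂ (by omega)) h.adj).mono
    (Set.image_subset_range _ _)

theorem exists_offset (h : RunsAround G L f) (i j : ℕ) : ∃ e < L, f j = f (i + e) := by
  have h3 := h.three_le
  have hi := Nat.mod_lt i (by omega : 0 < L)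
  -- This is `j - i` modulo `L`, written without truncated subtraction.
  refine ⟨(j + (L - i % L)) % L, Nat.mod_lt _ (by omega), (h.inj _ _).2 ?_⟩
  have h1 : i + (j + (L - i % L)) % L ≡ i % L + (j + (L - i % L)) [MOD L] :=
    Nat.ModEq.add (Nat.mod_modEq i L).symm (Nat.mod_modEq _ L)
  have h2 : i % L + (j + (L - i % L)) = j + L := by omega
  rw [h2] at h1
  exact (h1.trans (by simp [Nat.ModEq])).symm

/-- The other arc between two vertices of the cycle. -/
theorem arc_back (h : RunsAround G L f) (i : ℕ) {e : ℕ} (he : 0 < e) (heL : e ≤ L) :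
    PathIn G (Set.range f) (f i) (f (i + e)) (L - e) := by
  have := h.arc (i + e) (d := L - e) (by omega)
  rw [show i + e + (L - e) = i + L by omega, h.add_period] at this
  exact this.symm

theorem flexible (h : RunsAround G L f) (hL : Odd L) : Flexible G (Set.range f) := by
  rintro _ ⟨i, rfl⟩ _ ⟨j, rfl⟩ hne
  obtain ⟨e, he, hj⟩ := h.exists_offset i j
  rw [hj] at hne ⊢
  have he0 : 0 < e := by
    rcases Nat.eq_zero_or_pos e with rfl | h0
    · exact absurd rfl hne
    · exact h0
  have h₁ := h.arc i he
  have h₂ := h.arc_back i he0 he.le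
  rcases Nat.even_or_odd e with hev | hod
  · exact ⟨e, L - e, hev, Nat.Odd.sub_even he.le hL hev, h₁, h₂⟩
  · exact ⟨L - e, e, Nat.Odd.sub_odd hL hod, hod, h₂, h₁⟩

/-- Two neighbours on a shortest odd cycle of a vertex off the cycle have distance two on it. -/
theorem offset_eq_two (h : RunsAround G L f) (hL : Odd L)
    (hmin : ∀ k, Odd k → HasCycleOfLength G k → L ≤ k) {z p q : V}
    (hz : z ∉ Set.range f) (hp : p ∈ Set.range f) (hq : q ∈ Set.range f) (hzp : G.Adj z p)
    (hzq : G.Adj z q) (hpq : p ≠ q) :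
    ∃ i, (p = f i ∧ q = f (i + 2)) ∨ (q = f i ∧ p = f (i + 2)) := by
  obtain ⟨i, rfl⟩ := hp
  obtain ⟨j, rfl⟩ := hq
  obtain ⟨e, he, hj⟩ := h.exists_offset i j
  rw [hj] at hpq hzq ⊢
  have he0 : 0 < e := by
    rcases Nat.eq_zero_or_pos e with rfl | h0
    · exact absurd rfl hpq
    · exact h0
  have hd : Disjoint {z} (Set.range f) := by simpa using hz
  have key : ∀ m, 1 ≤ m → PathIn G (Set.range f) (f i) (f (i + e)) m → HasCycleOfLength G (m + 2) := by
    intro m hm hp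
    have := (PathIn.refl (T := {z}) (a := z) (G := G) rfl).hasCycle_of_disjoint hp hd hzp hzq.symm
      (by omega)
    simpa using this
  -- Closing the odd arc through `z` gives an odd cycle, so by minimality the even arc has length
  -- two.
  rcases Nat.even_or_odd e with hev | hod
  · have := hmin _ ((Nat.Odd.sub_even he.le hL hev).add_even even_two)
      (key (L - e) (by omega) (h.arc_back i he0 he.le))
    have he2 : e = 2 := by
      obtain ⟨r, hr⟩ := hev
      omega
    exact ⟨i, Or.inl ⟨rfl, by rw [he2]⟩⟩
  · have := hmin _ (hod.add_even even_two) (key e he0 (h.arc i he))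
    have he2 : e = L - 2 := by
      obtain ⟨r, hr⟩ := hod
      obtain ⟨s, hs⟩ := hL
      omega
    refine ⟨i + e, Or.inr ⟨rfl, ?_⟩⟩
    rw [show i + e + 2 = i + L by omega, h.add_period]

/-- A shortest odd cycle is induced, so a vertex of degree three has a neighbour off it. -/
theorem exists_notMem (hG : Critical G) (h : RunsAround G L f) (hL : Odd L)
    (hmin : ∀ k, Odd k → HasCycleOfLength G k → L ≤ k) : ∃ w ∉ Set.range f, G.Adj w (f 0) := by
  obtain ⟨w, hw, hw1, hw2⟩ := hG.degree (f 0) (f 1) (f (L - 1))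
  refine ⟨w, ?_, hw.symm⟩
  rintro ⟨j, rfl⟩
  have h3 := h.three_le
  obtain ⟨e, he, hj⟩ := h.exists_offset 0 j
  rw [Nat.zero_add] at hj
  rw [hj] at hw hw1 hw2
  have he0 : e ≠ 0 := by
    rintro rfl
    exact hw.ne rfl
  have he1 : e ≠ 1 := by
    rintro rfl
    exact hw1 rfl
  have he2 : e ≠ L - 1 := by
    rintro rfl
    exact hw2 rfl
  have ha := h.arc 0 he
  have hb := h.arc_back 0 (by omega) he.le
  rw [Nat.zero_add] at ha hb
  -- A chord closes the even arc to an odd cycle shorter than `L`.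
  rcases Nat.even_or_odd e with hev | hod
  · have := hmin _ hev.add_one (ha.hasCycle (by omega) hw.symm)
    omega
  · have := hmin _ (Nat.Odd.sub_odd hL hod).add_one (hb.hasCycle (by omega) hw.symm)
    omega

/-- If a vertex `z` is adjacent to two vertices of an odd cycle with distance two, a further
attachment of its component away from these vertices gives even cycles of consecutive lengths. -/
theorem consecutive_of_attachment (h : RunsAround G L f) (hL : Odd L) {d z z' : V} {i e : ℕ}
    (hz : z ∈ comp G (Set.range f)ᶜ d) (hz' : z' ∈ comp G (Set.range f)ᶜ d)
    (h₀ : G.Adj z (f i)) (h₂ : G.Adj z (f (i + 2))) (he3 : 3 ≤ e) (he : e < L)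
    (h' : G.Adj z' (f (i + e))) : HasTwoConsecutiveEvenCycles G := by
  obtain ⟨l, hl⟩ := (comp_connected z' hz' z hz).exists_pathIn
  have hd : Disjoint (comp G (Set.range f)ᶜ d) (Set.range f) :=
    Set.disjoint_left.2 fun v hv => comp_subset hv
  have h3 := h.three_le
  have close : ∀ {j m}, G.Adj z (f j) → PathIn G (Set.range f) (f j) (f (i + e)) m → 1 ≤ m →
      HasCycleOfLength G (l + m + 2) := fun hj hm h1 =>
    hl.hasCycle_of_disjoint hm hd hj h'.symm (by omega)
  -- The arcs to `f (i + e)` from `f i` and `f (i + 2)` have lengths `e` and `e - 2` in one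
  -- direction, `L - e` and `L - e + 2` in the other. As `L` is odd, one direction has the parity of
  -- `l`.
  rcases Nat.even_or_odd (l + e) with hev | hod
  · refine ⟨l + e, hev, ?_, close h₀ (h.arc i he) (by omega)⟩
    have harc := h.arc (i + 2) (d := e - 2) (by omega)
    rw [show i + 2 + (e - 2) = i + e by omega] at harc
    convert close h₂ harc (by omega) using 1
    omega
  · refine ⟨l + (L - e) + 2, ?_, close h₀ (h.arc_back i (by omega) he.le) (by omega), ?_⟩
    · obtain ⟨r, hr⟩ := hod
      obtain ⟨s, hs⟩ := hL
      exact ⟨l + s + 1 - r, by omega⟩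
    · have harc := (h.arc (i + e) (d := L + 2 - e) (by omega)).symm
      rw [show i + e + (L + 2 - e) = i + 2 + L by omega, h.add_period] at harc
      convert close h₂ harc (by omega) using 1
      omega

/-- If no vertex of the component sees two vertices of the cycle, flexibility suffices. Otherwise
some `z` sees `f i` and `f (i + 2)`. An attachment beyond `f i, f (i + 1), f (i + 2)` closes even
cycles directly. Without one, `u = f i` works, because seeing both `f (i + 1)` and `f (i + 2)` would
make a triangle. -/
theorem hasTwoConsecutiveEvenCycles [Finite V] (hG : Critical G) (h : RunsAround G L f)
    (hL : Odd L) (hL5 : 5 ≤ L) (hmin : ∀ k, Odd k → HasCycleOfLength G k → L ≤ k) :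
    HasTwoConsecutiveEvenCycles G := by
  obtain ⟨w, hw, hw0⟩ := h.exists_notMem hG hL hmin
  set S := Set.range f with hS
  have hDS : ∀ z ∈ comp G Sᶜ w, z ∉ S := fun z hz => comp_subset hz
  have hne : f 0 ≠ f 1 := (h.adj 0).ne
  by_cases htwo : ∃ z ∈ comp G Sᶜ w, ∃ i, G.Adj z (f i) ∧ G.Adj z (f (i + 2))
  · obtain ⟨z, hz, i, hz0, hz2⟩ := htwo
    by_cases hfar : ∃ z' ∈ comp G Sᶜ w, ∃ e, 3 ≤ e ∧ e < L ∧ G.Adj z' (f (i + e))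
    · obtain ⟨z', hz', e, he3, he, hadj⟩ := hfar
      exact h.consecutive_of_attachment hL hz hz' hz0 hz2 he3 he hadj
    · push Not at hfar
      have near : ∀ z' ∈ comp G Sᶜ w, ∀ p ∈ S, p ≠ f i → G.Adj z' p →
          p = f (i + 1) ∨ p = f (i + 2) := by
        rintro z' hz' _ ⟨j, rfl⟩ hp hadj
        obtain ⟨e, he, hj⟩ := h.exists_offset i j
        rw [hj] at hadj hp ⊢
        by_cases he3 : 3 ≤ e
        · exact absurd hadj (hfar z' hz' e he3 he)
        · have : e = 0 ∨ e = 1 ∨ e = 2 := by omega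
          rcases this with rfl | rfl | rfl
          exacts [absurd rfl hp, Or.inl rfl, Or.inr rfl]
      have notri : ∀ z' ∈ comp G Sᶜ w, G.Adj z' (f (i + 1)) → G.Adj z' (f (i + 2)) → False := by
        intro z' hz' h₁ h₂
        have hd : Disjoint {z'} S := by simpa using hDS z' hz'
        have := (PathIn.refl (T := {z'}) (a := z') (G := G) rfl).hasCycle_of_disjoint
          (h.arc (i + 1) (d := 1) (by omega)) hd h₁ h₂.symm (by omega)
        have := hmin 3 (by decide) (by simpa using this)
        omega
      refine (h.flexible hL).hasTwoConsecutiveEvenCycles hG (u := f i) (d := w) ⟨i, rfl⟩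
        ⟨f (i + 1), ⟨i + 1, rfl⟩, (h.adj i).ne'⟩ ⟨z, hz, hz0⟩ ?_
      intro z' hz' p hp q hq hpu hqu hzp hzq
      rcases near z' hz' p hp hpu hzp with rfl | rfl <;>
        rcases near z' hz' q hq hqu hzq with rfl | rfl
      · rfl
      · exact (notri z' hz' hzp hzq).elim
      · exact (notri z' hz' hzq hzp).elim
      · rfl
  · refine (h.flexible hL).hasTwoConsecutiveEvenCycles hG (u := f 0) (d := w) ⟨0, rfl⟩
      ⟨f 1, ⟨1, rfl⟩, hne.symm⟩ ⟨w, LinkedIn.refl hw, hw0⟩ ?_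
    rintro z hz p hp q hq - - hzp hzq
    by_contra hpq
    obtain ⟨i, ⟨rfl, rfl⟩ | ⟨rfl, rfl⟩⟩ := h.offset_eq_two hL hmin (hDS z hz) hp hq hzp hzq hpq
    exacts [htwo ⟨z, hz, i, hzp, hzq⟩, htwo ⟨z, hz, i, hzq, hzp⟩]

end RunsAround

/-! ### Critical graphs have the two cycles -/

/-- A triangle is flexible, and a vertex outside that sees two of its vertices completes a diamond.
-/
theorem hasTwoConsecutiveEvenCycles_of_triangle [Finite V] (hG : Critical G)
    (hV : ∀ s : Finset V, s.card ≤ 5 → ∃ v, v ∉ s) {a b c : V} (hab : G.Adj a b) (hac : G.Adj a c)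
    (hbc : G.Adj b c) : HasTwoConsecutiveEvenCycles G := by
  by_contra hP
  obtain ⟨w, haw, hwb, hwc⟩ := hG.degree a b c
  have hw : w ∉ ({a, b, c} : Set V) := by simp [haw.ne', hwb, hwc]
  have hflex : Flexible G ({a, b, c} : Set V) := by
    refine flexible_insert ?_ ?_
    · rintro r (rfl | rfl)
      exacts [hab, hac]
    · rintro r (rfl | rfl)
      exacts [⟨c, by simp, hbc⟩, ⟨b, by simp, hbc.symm⟩]
  have hdia : ∀ z, z ≠ a → G.Adj z b → G.Adj z c → False := fun z hza hzb hzc => hP <|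
    IsDiamond.hasTwoConsecutiveEvenCycles hG hV (a := b) (b := c) (c := a) (d := z)
      ⟨hbc, hab.symm, hzb.symm, hac.symm, hzc.symm, hza.symm⟩
  refine hP (hflex.hasTwoConsecutiveEvenCycles hG (u := a) (d := w) (by simp)
    ⟨b, by simp, hab.ne'⟩ ⟨w, LinkedIn.refl hw, haw.symm⟩ ?_)
  intro z hz p hp q hq hpa hqa hzp hzq
  have hza : z ≠ a := by
    rintro rfl
    exact comp_subset hz (by simp)
  rcases hp.resolve_left hpa with rfl | rfl <;> rcases hq.resolve_left hqa with rfl | rfl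
  · rfl
  · exact (hdia z hza hzp hzq).elim
  · exact (hdia z hza hzq hzp).elim
  · rfl

/-- With `S` an edge `x y`, the uniqueness condition is vacuous, and the cycles obtained differ by
two in length: both are even or both are odd. -/
theorem Critical.exists_odd_cycle [Finite V] (hG : Critical G)
    (hV : ∀ s : Finset V, s.card ≤ 5 → ∃ v, v ∉ s) :
    HasTwoConsecutiveEvenCycles G ∨ ∃ k, Odd k ∧ HasCycleOfLength G k := by
  classical
  obtain ⟨x, -⟩ := hV ∅ (by simp)
  obtain ⟨y, hxy, -⟩ := hG.degree x x x
  obtain ⟨d, hd⟩ := hV {x, y} (Finset.card_le_two.trans (by norm_num))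
  have hdS : d ∉ ({x, y} : Set V) := by simpa using hd
  have hDS : ∀ z ∈ comp G ({x, y} : Set V)ᶜ d, z ∉ ({x, y} : Set V) := fun z hz => comp_subset hz
  obtain ⟨k, hk, v, hv, hvy, hkv⟩ := hG.noCut (comp G ({x, y} : Set V)ᶜ d)
    ⟨d, LinkedIn.refl hdS⟩ y (fun h => hDS y h (by simp)) ⟨x, fun h => hDS x h (by simp), hxy.ne⟩
  have hvx : v = x := by
    have : v ∈ ({x, y} : Set V) := by
      by_contra h
      exact hv (comp_closed k hk v h hkv)
    exact this.resolve_right hvy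
  obtain ⟨y', hy', hne, n, hn⟩ := exists_cycles_through hG (S := {x, y}) (u := x) (d := d)
    (by simp) ⟨y, by simp, hxy.ne'⟩ ⟨k, hk, hvx ▸ hkv⟩ (by
      rintro z - p hp q hq hpx hqx - -
      rw [hp.resolve_left hpx, hq.resolve_left hqx])
  obtain rfl : y' = y := hy'.resolve_left hne
  obtain ⟨h₁, h₂⟩ := hn 1 (PathIn.single hxy).symm
  rcases Nat.even_or_odd (n + 1) with h | h
  · exact Or.inl ⟨n + 1, h, h₁, h₂⟩
  · exact Or.inr ⟨n + 1, h, h₁⟩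

/-- A critical graph with at least six vertices has two cycles of consecutive even lengths. -/
theorem Critical.hasTwoConsecutiveEvenCycles [Finite V] (hG : Critical G)
    (hV : ∀ s : Finset V, s.card ≤ 5 → ∃ v, v ∉ s) : HasTwoConsecutiveEvenCycles G := by
  classical
  rcases hG.exists_odd_cycle hV with h | hodd
  · exact h
  · obtain ⟨hL, hcyc⟩ := Nat.find_spec hodd
    have hmin : ∀ k, Odd k → HasCycleOfLength G k → Nat.find hodd ≤ k :=
      fun k hk hc => Nat.find_min' hodd ⟨hk, hc⟩
    obtain ⟨f, hf⟩ := hcyc.exists_runsAround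
    have h3 := hf.three_le
    by_cases h5 : 5 ≤ Nat.find hodd
    · exact hf.hasTwoConsecutiveEvenCycles hG hL h5 hmin
    · have hL3 : Nat.find hodd = 3 := by
        obtain ⟨r, hr⟩ := hL
        omega
      have h0 := hf.add_period 0
      rw [hL3] at h0
      have h2 := hf.adj 2
      rw [show 2 + 1 = 0 + 3 from rfl, h0] at h2
      exact hasTwoConsecutiveEvenCycles_of_triangle hG hV (hf.adj 0) h2.symm (hf.adj 1)

theorem HasTwoConsecutiveEvenCycles.map {W : Type*} {H : SimpleGraph W} (f : H ↪g G)
    (h : HasTwoConsecutiveEvenCycles H) : HasTwoConsecutiveEvenCycles G := by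
  obtain ⟨m, hm, h₁, h₂⟩ := h
  exact ⟨m, hm, h₁.map f, h₂.map f⟩

/-! ### Counting edges and separations -/

/-- The pairs of adjacent vertices of `S`. -/
noncomputable def adjPairs (G : SimpleGraph V) (S : Finset V) : Finset (V × V) := by
  classical exact (S ×ˢ S).filter fun p => G.Adj p.1 p.2

theorem mem_adjPairs {S : Finset V} {p : V × V} :
    p ∈ adjPairs G S ↔ p.1 ∈ S ∧ p.2 ∈ S ∧ G.Adj p.1 p.2 := by
  simp [adjPairs, and_assoc]

/-- Twice the number of edges induced on `S`. -/
noncomputable def degSum (G : SimpleGraph V) (S : Finset V) : ℕ := (adjPairs G S).card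

theorem degSum_univ [Fintype V] [DecidableRel G.Adj] :
    degSum G Finset.univ = 2 * G.edgeFinset.card := by
  classical
  rw [← G.sum_degrees_eq_twice_card_edges, degSum]
  have : adjPairs G Finset.univ = Finset.univ.filter fun p : V × V => G.Adj p.1 p.2 := by
    ext p
    simp [mem_adjPairs]
  rw [this, Finset.card_filter, ← Finset.univ_product_univ, Finset.sum_product]
  refine Finset.sum_congr rfl fun v _ => ?_
  rw [← Finset.card_filter, ← card_neighborFinset_eq_degree, neighborFinset_eq_filter]

/-- `S` is the union of `S₁` and `S₂`, which have at most one common vertex and no edges between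
their differences. -/
structure Separates (G : SimpleGraph V) (S S₁ S₂ : Finset V) : Prop where
  mem : ∀ x, x ∈ S ↔ x ∈ S₁ ∨ x ∈ S₂
  inter : ∀ x y, x ∈ S₁ → x ∈ S₂ → y ∈ S₁ → y ∈ S₂ → x = y
  cross : ∀ a ∈ S₁, ∀ b ∈ S₂, G.Adj a b → a ∈ S₂ ∨ b ∈ S₁

theorem Separates.degSum_eq {S S₁ S₂ : Finset V} (h : Separates G S S₁ S₂) :
    degSum G S = degSum G S₁ + degSum G S₂ := by
  classical
  rw [degSum, degSum, degSum, ← Finset.card_union_of_disjoint]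
  · congr 1
    ext ⟨a, b⟩
    simp only [mem_adjPairs, Finset.mem_union, h.mem]
    constructor
    · rintro ⟨ha | ha, hb | hb, hab⟩
      · exact Or.inl ⟨ha, hb, hab⟩
      · rcases h.cross a ha b hb hab with h' | h'
        exacts [Or.inr ⟨h', hb, hab⟩, Or.inl ⟨ha, h', hab⟩]
      · rcases h.cross b hb a ha hab.symm with h' | h'
        exacts [Or.inr ⟨ha, h', hab⟩, Or.inl ⟨h', hb, hab⟩]
      · exact Or.inr ⟨ha, hb, hab⟩
    · rintro (⟨ha, hb, hab⟩ | ⟨ha, hb, hab⟩)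
      exacts [⟨Or.inl ha, Or.inl hb, hab⟩, ⟨Or.inr ha, Or.inr hb, hab⟩]
  · rw [Finset.disjoint_left]
    rintro ⟨a, b⟩ h₁ h₂
    rw [mem_adjPairs] at h₁ h₂
    exact h₁.2.2.ne (h.inter a b h₁.1 h₂.1 h₁.2.1 h₂.2.1)

theorem Separates.card_eq {S S₁ S₂ : Finset V} (h : Separates G S S₁ S₂) :
    (∃ v ∈ S₁, v ∈ S₂ ∧ S.card + 1 = S₁.card + S₂.card) ∨ S.card = S₁.card + S₂.card := by
  classical
  have hS : S = S₁ ∪ S₂ := by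
    ext x
    simp [h.mem]
  have hc := Finset.card_union_add_card_inter S₁ S₂
  rw [← hS] at hc
  have hle : (S₁ ∩ S₂).card ≤ 1 := Finset.card_le_one.2 fun x hx y hy => by
    rw [Finset.mem_inter] at hx hy
    exact h.inter x y hx.1 hx.2 hy.1 hy.2
  rcases Nat.eq_zero_or_pos (S₁ ∩ S₂).card with h0 | h0
  · right
    omega
  · obtain ⟨v, hv⟩ := Finset.card_pos.1 h0
    rw [Finset.mem_inter] at hv
    exact Or.inl ⟨v, hv.1, hv.2, by omega⟩

/-- A lost pair has `v` as its first or second entry and a vertex of `N` as the other, hence the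
factor two. -/
theorem degSum_le_erase [DecidableEq V] {S N : Finset V} {v : V}
    (hN : ∀ u ∈ S, G.Adj v u → u ∈ N) : degSum G S ≤ degSum G (S.erase v) + 2 * N.card := by
  have hsub : adjPairs G S ⊆
      adjPairs G (S.erase v) ∪ (N.image (fun u => (v, u)) ∪ N.image fun u => (u, v)) := by
    rintro ⟨a, b⟩ hab
    rw [mem_adjPairs] at hab
    obtain ⟨ha, hb, hab⟩ := hab
    simp only [Finset.mem_union, mem_adjPairs, Finset.mem_erase, Finset.mem_image, Prod.mk.injEq]
    by_cases hav : a = v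
    · subst hav
      exact Or.inr (Or.inl ⟨b, hN b hb hab, rfl, rfl⟩)
    · by_cases hbv : b = v
      · subst hbv
        exact Or.inr (Or.inr ⟨a, hN a ha hab.symm, rfl, rfl⟩)
      · exact Or.inl ⟨⟨hav, ha⟩, ⟨hbv, hb⟩, hab⟩
  have h₁ := Finset.card_le_card hsub
  have h₂ := Finset.card_union_le (adjPairs G (S.erase v))
    (N.image (fun u => (v, u)) ∪ N.image fun u => (u, v))
  have h₃ := Finset.card_union_le (N.image fun u => (v, u)) (N.image fun u => (u, v))
  have h₄ : (N.image fun u => (v, u)).card ≤ N.card := Finset.card_image_le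
  have h₅ : (N.image fun u => (u, v)).card ≤ N.card := Finset.card_image_le
  rw [degSum, degSum]
  omega

theorem degSum_le {S : Finset V} : degSum G S + S.card ≤ S.card * S.card := by
  classical
  have hsub : adjPairs G S ⊆ S.offDiag := by
    intro p hp
    rw [mem_adjPairs] at hp
    exact Finset.mem_offDiag.2 ⟨hp.1, hp.2.1, hp.2.2.ne⟩
  have h := Finset.card_le_card hsub
  rw [Finset.offDiag_card] at h
  have : S.card ≤ S.card * S.card := Nat.le_mul_self _
  rw [degSum]
  omega

theorem degSum_lt {S : Finset V} {a b : V} (ha : a ∈ S) (hb : b ∈ S) (hab : a ≠ b)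
    (hn : ¬ G.Adj a b) : degSum G S + S.card < S.card * S.card := by
  classical
  have hsub : adjPairs G S ⊂ S.offDiag := by
    refine ⟨fun p hp => ?_, fun h => ?_⟩
    · rw [mem_adjPairs] at hp
      exact Finset.mem_offDiag.2 ⟨hp.1, hp.2.1, hp.2.2.ne⟩
    · have := h (Finset.mem_offDiag.2 ⟨ha, hb, hab⟩ : (a, b) ∈ S.offDiag)
      exact hn (mem_adjPairs.1 this).2.2
  have h := Finset.card_lt_card hsub
  rw [Finset.offDiag_card] at h
  have : S.card ≤ S.card * S.card := Nat.le_mul_self _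
  rw [degSum]
  omega

/-! ### Trees of cliques of order five -/

/-- `S` consists of cliques of order five that are glued together at single vertices. -/
inductive K5Tree (G : SimpleGraph V) : Finset V → Prop
  | single (v : V) : K5Tree G {v}
  | clique (Q : Finset V) (hQ : Q.card = 5) (hadj : ∀ u ∈ Q, ∀ v ∈ Q, u ≠ v → G.Adj u v) :
      K5Tree G Q
  | glue (S S₁ S₂ : Finset V) (v : V) (h₁ : K5Tree G S₁) (h₂ : K5Tree G S₂)
      (h : Separates G S S₁ S₂) (hv₁ : v ∈ S₁) (hv₂ : v ∈ S₂) : K5Tree G S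

namespace K5Tree

variable {S : Finset V}

theorem card_eq (h : K5Tree G S) : ∃ k, S.card = 4 * k + 1 := by
  induction h with
  | single v => exact ⟨0, by simp⟩
  | clique Q hQ _ => exact ⟨1, hQ⟩
  | glue S S₁ S₂ v _ _ h hv₁ hv₂ ih₁ ih₂ =>
    classical
    obtain ⟨k₁, hk₁⟩ := ih₁
    obtain ⟨k₂, hk₂⟩ := ih₂
    have hS : S = S₁ ∪ S₂ := by
      ext x
      simp [h.mem]
    have hi : S₁ ∩ S₂ = {v} := by
      ext x
      rw [Finset.mem_inter, Finset.mem_singleton]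
      exact ⟨fun hx => h.inter x v hx.1 hx.2 hv₁ hv₂, fun hx => hx ▸ ⟨hv₁, hv₂⟩⟩
    have hc := Finset.card_union_add_card_inter S₁ S₂
    rw [← hS, hi, Finset.card_singleton] at hc
    exact ⟨k₁ + k₂, by omega⟩

theorem nonempty (h : K5Tree G S) : S.Nonempty := by
  obtain ⟨k, hk⟩ := h.card_eq
  exact Finset.card_pos.1 (by omega)

/-- The excess is at most zero for a vertex and for five vertices, and it is additive under gluing.
In `k5Tree_of_dense` this bounds the dense proper subsets from above. -/
theorem degSum_add_le (h : K5Tree G S) : degSum G S + 5 ≤ 5 * S.card := by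
  induction h with
  | single v =>
    have := degSum_le (G := G) (S := {v})
    simp at this ⊢
    omega
  | clique Q hQ _ =>
    have := degSum_le (G := G) (S := Q)
    rw [hQ] at this ⊢
    omega
  | glue S S₁ S₂ v _ _ h hv₁ hv₂ ih₁ ih₂ =>
    rw [h.degSum_eq]
    rcases h.card_eq with ⟨-, -, -, hc⟩ | hc <;> omega

/-- Two vertices are joined by paths of four consecutive lengths. -/
theorem exists_paths (h : K5Tree G S) : ∀ u ∈ S, ∀ v ∈ S, u ≠ v →
    ∃ l, ∀ i ≤ 3, PathIn G (S : Set V) u v (l + i) := by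
  classical
  induction h with
  | single v =>
    intro u hu w hw huw
    rw [Finset.mem_singleton] at hu hw
    exact absurd (hu.trans hw.symm) huw
  | clique Q hQ hadj =>
    intro u hu v hv huv
    have hcard : ((Q.erase u).erase v).card = 3 := by
      rw [Finset.card_erase_of_mem (Finset.mem_erase.2 ⟨huv.symm, hv⟩),
        Finset.card_erase_of_mem hu, hQ]
    obtain ⟨x, y, z, hxy, hxz, hyz, hset⟩ := Finset.card_eq_three.1 hcard
    have hmem : ∀ w ∈ ({x, y, z} : Finset V), w ≠ v ∧ w ≠ u ∧ w ∈ Q := fun w hw => by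
      rw [← hset, Finset.mem_erase, Finset.mem_erase] at hw
      exact hw
    obtain ⟨hxv, hxu, hx⟩ := hmem x (by simp)
    obtain ⟨hyv, hyu, hy⟩ := hmem y (by simp)
    obtain ⟨hzv, hzu, hz⟩ := hmem z (by simp)
    -- Putting in the other three vertices one by one yields the lengths 1 to 4.
    have p₁ := PathIn.single (hadj u hu v hv huv)
    have q₁ := PathIn.single (hadj x hx v hv hxv)
    have p₂ := q₁.cons (hadj u hu x hx hxu.symm) (by simp [huv, hxu.symm])
    have q₂ := q₁.cons (hadj y hy x hx hxy.symm) (by simp [hyv, hxy.symm])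
    have p₃ := q₂.cons (hadj u hu y hy hyu.symm) (by simp [huv, hxu.symm, hyu.symm])
    have q₃ := q₂.cons (hadj z hz y hy hyz.symm) (by simp [hzv, hxz.symm, hyz.symm])
    have p₄ := q₃.cons (hadj u hu z hz hzu.symm) (by simp [huv, hxu.symm, hyu.symm, hzu.symm])
    have e₁ : ({u, v} : Set V) ⊆ Q := by
      rintro w (rfl | rfl) <;> assumption
    have e₂ : (insert u {x, v} : Set V) ⊆ Q := by
      rintro w (rfl | rfl | rfl) <;> assumption
    have e₃ : (insert u (insert y {x, v}) : Set V) ⊆ Q := by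
      rintro w (rfl | rfl | rfl | rfl) <;> assumption
    have e₄ : (insert u (insert z (insert y {x, v})) : Set V) ⊆ Q := by
      rintro w (rfl | rfl | rfl | rfl | rfl) <;> assumption
    refine ⟨1, fun i hi => ?_⟩
    interval_cases i
    exacts [p₁.mono e₁, p₂.mono e₂, p₃.mono e₃, p₄.mono e₄]
  | glue S S₁ S₂ v _ _ h hv₁ hv₂ ih₁ ih₂ =>
    have hs₁ : (S₁ : Set V) ⊆ S := fun x hx => (h.mem x).2 (Or.inl hx)
    have hs₂ : (S₂ : Set V) ⊆ S := fun x hx => (h.mem x).2 (Or.inr hx)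
    have across : ∀ u ∈ S₁, ∀ w ∈ S₂, u ≠ w →
        ∃ l, ∀ i ≤ 3, PathIn G (S : Set V) u w (l + i) := by
      intro u hu w hw huw
      by_cases huv : u = v
      · subst huv
        obtain ⟨l, hl⟩ := ih₂ u hv₂ w hw huw
        exact ⟨l, fun i hi => (hl i hi).mono hs₂⟩
      · by_cases hwv : w = v
        · subst hwv
          obtain ⟨l, hl⟩ := ih₁ u hu w hv₁ huw
          exact ⟨l, fun i hi => (hl i hi).mono hs₁⟩
        · obtain ⟨l₁, hl₁⟩ := ih₁ u hu v hv₁ huv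
          obtain ⟨l₂, hl₂⟩ := ih₂ v hv₂ w hw (Ne.symm hwv)
          -- Only the path in `S₁` varies in length; the one in `S₂` stays at `l₂`.
          refine ⟨l₁ + l₂, fun i hi => ?_⟩
          have := ((hl₁ i hi).append (hl₂ 0 (by omega)) fun x hx hx' =>
            h.inter x v hx hx' hv₁ hv₂).mono (Set.union_subset hs₁ hs₂)
          rwa [show l₁ + i + (l₂ + 0) = l₁ + l₂ + i by omega] at this
    intro u hu w hw huw
    rcases (h.mem u).1 hu with hu' | hu' <;> rcases (h.mem w).1 hw with hw' | hw'
    · obtain ⟨l, hl⟩ := ih₁ u hu' w hw' huw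
      exact ⟨l, fun i hi => (hl i hi).mono hs₁⟩
    · exact across u hu' w hw' huw
    · obtain ⟨l, hl⟩ := across w hw' u hu' huw.symm
      exact ⟨l, fun i hi => (hl i hi).symm⟩
    · obtain ⟨l, hl⟩ := ih₂ u hu' w hw' huw
      exact ⟨l, fun i hi => (hl i hi).mono hs₂⟩

/-- An ear of a glued clique tree closes two cycles of consecutive even lengths. -/
theorem hasTwoConsecutiveEvenCycles (h : K5Tree G S) {A : Set V} {a₁ a₂ b₁ b₂ : V}
    (hA : Disjoint A (S : Set V)) (hl : LinkedIn G A a₁ a₂) (hb₁ : b₁ ∈ S) (hb₂ : b₂ ∈ S)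
    (hb : b₁ ≠ b₂) (h₁ : G.Adj a₁ b₁) (h₂ : G.Adj a₂ b₂) : HasTwoConsecutiveEvenCycles G := by
  obtain ⟨n, hn⟩ := hl.exists_pathIn
  obtain ⟨l, hl⟩ := h.exists_paths b₂ hb₂ b₁ hb₁ hb.symm
  have hl0 := (hl 0 (by omega)).pos_of_ne hb.symm
  have hc : ∀ i ≤ 3, HasCycleOfLength G (n + (l + i) + 2) := fun i hi =>
    hn.hasCycle_of_disjoint (hl i hi) hA h₂ h₁.symm (by omega)
  -- Among four consecutive lengths, `l, l + 2` or `l + 1, l + 3` have the parity needed.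
  rcases Nat.even_or_odd (n + l) with hev | hod
  · exact ⟨n + (l + 0) + 2, hev.add even_two, hc 0 (by omega), hc 2 (by omega)⟩
  · exact ⟨n + (l + 1) + 2, (hod.add_one).add even_two, hc 1 (by omega), hc 3 (by omega)⟩

end K5Tree

/-! ### Dense sets -/

/-- `S` cannot be separated by at most one of its vertices. -/
def Nonseparable (G : SimpleGraph V) (S : Finset V) : Prop :=
  ∀ A ⊆ S, A.Nonempty → ∀ v ∈ S, v ∉ A → (∃ w ∈ S, w ∉ A ∧ w ≠ v) →
    ∃ a ∈ A, ∃ b ∈ S, b ∉ A ∧ b ≠ v ∧ G.Adj a b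

/-- Nonseparability gives `A` neighbours at two different vertices of the rest, so the connected set
`A` contains an ear of the clique tree. -/
theorem Nonseparable.hasTwoConsecutiveEvenCycles [DecidableEq V] {S A : Finset V}
    (h : Nonseparable G S) (hAS : A ⊆ S) (hA : A.Nonempty)
    (hconn : ∀ a ∈ A, ∀ b ∈ A, LinkedIn G (A : Set V) a b)
    (ht : K5Tree G (S \ A)) (hc : 2 ≤ (S \ A).card) : HasTwoConsecutiveEvenCycles G := by
  have other : ∀ v ∈ S \ A, ∃ a ∈ A, ∃ b ∈ S \ A, b ≠ v ∧ G.Adj a b := by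
    intro v hv
    obtain ⟨w, hw, hwv⟩ := Finset.exists_mem_ne (by omega : 1 < (S \ A).card) v
    rw [Finset.mem_sdiff] at hv hw
    obtain ⟨a, ha, b, hb, hbA, hbv, hab⟩ := h A hAS hA v hv.1 hv.2 ⟨w, hw.1, hw.2, hwv⟩
    exact ⟨a, ha, b, Finset.mem_sdiff.2 ⟨hb, hbA⟩, hbv, hab⟩
  obtain ⟨v, hv⟩ := ht.nonempty
  obtain ⟨a₁, ha₁, b₁, hb₁, -, hab₁⟩ := other v hv
  obtain ⟨a₂, ha₂, b₂, hb₂, hne, hab₂⟩ := other b₁ hb₁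
  refine ht.hasTwoConsecutiveEvenCycles (A := A) ?_ (hconn a₁ ha₁ a₂ ha₂) hb₁ hb₂ hne.symm hab₁ hab₂
  rw [Finset.disjoint_coe]
  exact Finset.disjoint_sdiff

/-- A set that is not nonseparable has a separation into smaller sets. -/
theorem exists_separates {S : Finset V} (h : ¬ Nonseparable G S) :
    ∃ S₁ S₂, Separates G S S₁ S₂ ∧ S₁.Nonempty ∧ S₂.Nonempty ∧ S₁ ⊂ S ∧ S₂ ⊂ S := by
  classical
  rw [Nonseparable] at h
  push Not at h
  obtain ⟨A, hAS, hA, v, hv, hvA, ⟨w, hw, hwA, hwv⟩, hno⟩ := h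
  refine ⟨insert v A, S \ A, ⟨?_, ?_, ?_⟩, ⟨v, by simp⟩, ⟨v, by simp [hv, hvA]⟩, ?_, ?_⟩
  · intro x
    simp only [Finset.mem_insert, Finset.mem_sdiff]
    constructor
    · intro hx
      by_cases hxA : x ∈ A
      · exact Or.inl (Or.inr hxA)
      · exact Or.inr ⟨hx, hxA⟩
    · rintro ((rfl | hx) | hx)
      exacts [hv, hAS hx, hx.1]
  · have key : ∀ x, x ∈ insert v A → x ∈ S \ A → x = v := by
      intro x hx hx'
      rw [Finset.mem_insert] at hx
      exact hx.resolve_right (Finset.mem_sdiff.1 hx').2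
    intro x y hx hx' hy hy'
    rw [key x hx hx', key y hy hy']
  · intro a ha b hb hab
    rw [Finset.mem_sdiff] at hb
    rcases Finset.mem_insert.1 ha with rfl | ha
    · exact Or.inl (Finset.mem_sdiff.2 ⟨hv, hvA⟩)
    · by_cases hbv : b = v
      · exact Or.inr (Finset.mem_insert.2 (Or.inl hbv))
      · exact absurd hab (hno a ha b hb.1 hb.2 hbv)
  · refine Finset.ssubset_iff_of_subset ?_ |>.2 ⟨w, hw, by simp [hwA, hwv]⟩
    exact Finset.insert_subset hv hAS
  · obtain ⟨a, ha⟩ := hA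
    exact Finset.ssubset_iff_of_subset Finset.sdiff_subset |>.2 ⟨a, hAS ha, by simp [ha]⟩

/-- A nonseparable set with at least six vertices that is denser than all its subsets induces a
critical graph. -/
theorem Nonseparable.critical {S : Finset V} (h : Nonseparable G S)
    (hP : ¬ HasTwoConsecutiveEvenCycles G) (hS : 6 ≤ S.card) (hd : 5 * S.card ≤ degSum G S + 5)
    (ih : ∀ T ⊂ S, T.Nonempty → 5 * T.card ≤ degSum G T + 5 → K5Tree G T) :
    Critical (G.induce (S : Set V)) := by
  classical
  -- If deleting `A` costs at most `5 |A|` in `degSum`, the rest is still dense, hence a clique tree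
  -- with `A` as an ear.
  have contra : ∀ A ⊆ S, A.Nonempty → (∀ a ∈ A, ∀ b ∈ A, LinkedIn G (A : Set V) a b) →
      A.card ≤ 2 → degSum G S ≤ degSum G (S \ A) + 5 * A.card → False := by
    intro A hAS hA hconn hA2 hdeg
    have hc := Finset.card_sdiff_add_card_eq_card hAS
    obtain ⟨a, ha⟩ := hA
    have ht := ih (S \ A) (Finset.ssubset_iff_of_subset Finset.sdiff_subset |>.2
      ⟨a, hAS ha, by simp [ha]⟩) (Finset.card_pos.1 (by omega)) (by omega)
    exact hP (h.hasTwoConsecutiveEvenCycles hAS ⟨a, ha⟩ hconn ht (by omega))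
  refine ⟨?_, ?_, ?_⟩
  · rintro ⟨t, ht⟩ ⟨u, hu⟩ ⟨v, hv⟩
    by_contra hno
    push Not at hno
    refine contra {t} (by simpa using ht) (by simp) ?_ (by simp) ?_
    · intro a ha b hb
      rw [Finset.mem_singleton] at ha hb
      rw [ha, hb]
      exact LinkedIn.refl (by simp)
    -- At most two edges are lost, and `2 * 2 ≤ 5`.
    · have := degSum_le_erase (G := G) (S := S) (N := {u, v}) (v := t) (by
        intro w hw htw
        have := hno ⟨w, hw⟩ (by simpa using htw)
        simp only [ne_eq, Subtype.mk.injEq] at this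
        rw [Finset.mem_insert, Finset.mem_singleton]
        tauto)
      rw [Finset.sdiff_singleton_eq_erase, Finset.card_singleton]
      have h2 : ({u, v} : Finset V).card ≤ 2 := Finset.card_le_two
      omega
  · rintro ⟨t, ht⟩ ⟨t', ht'⟩ htt'
    have hadj : G.Adj t t' := by simpa using htt'
    by_contra hno
    push Not at hno
    obtain ⟨⟨⟨u, hu⟩, ⟨v, hv⟩, h₁⟩, ⟨⟨u', hu'⟩, ⟨v', hv'⟩, h₂⟩⟩ := hno
    refine contra {t, t'} ?_ (by simp) ?_ Finset.card_le_two ?_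
    · rintro x hx
      rw [Finset.mem_insert, Finset.mem_singleton] at hx
      rcases hx with rfl | rfl
      exacts [ht, ht']
    · intro a ha b hb
      rw [Finset.mem_insert, Finset.mem_singleton] at ha hb
      rcases ha with rfl | rfl <;> rcases hb with rfl | rfl
      · exact LinkedIn.refl (by simp)
      · exact LinkedIn.adj hadj (by simp) (by simp)
      · exact LinkedIn.adj hadj.symm (by simp) (by simp)
      · exact LinkedIn.refl (by simp)
    -- At most `3 + 2` edges are lost, since the common edge counts once, and `2 * (3 + 2) = 5 * 2`.
    · have e₁ := degSum_le_erase (G := G) (S := S) (N := {t', u, v}) (v := t) (by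
        intro w hw htw
        have := h₁ ⟨w, hw⟩ (by simpa using htw)
        simp only [ne_eq, Subtype.mk.injEq] at this
        rw [Finset.mem_insert, Finset.mem_insert, Finset.mem_singleton]
        tauto)
      have e₂ := degSum_le_erase (G := G) (S := S.erase t) (N := {u', v'}) (v := t') (by
        intro w hw htw
        rw [Finset.mem_erase] at hw
        have := h₂ ⟨w, hw.2⟩ (by simpa using htw)
        simp only [ne_eq, Subtype.mk.injEq] at this
        rw [Finset.mem_insert, Finset.mem_singleton]
        tauto)
      have hset : (S.erase t).erase t' = S \ {t, t'} := by
        ext x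
        simp only [Finset.mem_erase, Finset.mem_sdiff, Finset.mem_insert, Finset.mem_singleton]
        tauto
      rw [hset] at e₂
      have c₁ : ({t', u, v} : Finset V).card ≤ 3 := Finset.card_le_three
      have c₂ : ({u', v'} : Finset V).card ≤ 2 := Finset.card_le_two
      rw [Finset.card_pair hadj.ne]
      omega
  · rintro K ⟨k, hk⟩ ⟨n, hnS⟩ hnK ⟨⟨w, hwS⟩, hwK, hwn⟩
    have hmem : ∀ x (hx : x ∈ (S : Set V)),
        x ∈ S.filter (fun x => ∃ hx : x ∈ (S : Set V), (⟨x, hx⟩ : (S : Set V)) ∈ K) ↔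
          (⟨x, hx⟩ : (S : Set V)) ∈ K := by
      intro x hx
      rw [Finset.mem_filter]
      exact ⟨fun h => h.2.2, fun h => ⟨hx, hx, h⟩⟩
    obtain ⟨a, ha, b, hb, hbA, hbn, hab⟩ := h
      (S.filter (fun x => ∃ hx : x ∈ (S : Set V), (⟨x, hx⟩ : (S : Set V)) ∈ K))
      (Finset.filter_subset _ _) ⟨k, (hmem _ k.2).2 hk⟩ n hnS
      (fun h => hnK ((hmem n hnS).1 h)) ⟨w, hwS, fun h => hwK ((hmem w hwS).1 h), by
        simpa using hwn⟩
    obtain ⟨haS, haK⟩ := (Finset.mem_filter.1 ha).2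
    exact ⟨⟨a, haS⟩, haK, ⟨b, hb⟩, fun h => hbA ((hmem b hb).2 h), by simpa using hbn,
      by simpa using hab⟩

/-- A smallest counterexample is neither nonseparable with six or more vertices, by the theorem on
critical graphs, nor separable, by additivity of the excess. Sets of at most five vertices are
settled by counting. -/
theorem k5Tree_of_dense (hP : ¬ HasTwoConsecutiveEvenCycles G) (S : Finset V)
    (hS : S.Nonempty) (hd : 5 * S.card ≤ degSum G S + 5) : K5Tree G S := by
  induction S using Finset.strongInduction with
  | H S ih =>
    have upper : ∀ T ⊂ S, T.Nonempty → degSum G T + 5 ≤ 5 * T.card := by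
      intro T hT hTn
      by_cases h : 5 * T.card ≤ degSum G T + 5
      · exact (ih T hT hTn h).degSum_add_le
      · omega
    by_cases hsep : Nonseparable G S
    · have hpos := Finset.card_pos.2 hS
      by_cases h6 : 6 ≤ S.card
      · have hcrit := hsep.critical hP h6 hd ih
        refine absurd ((hcrit.hasTwoConsecutiveEvenCycles ?_).map (Embedding.induce _)) hP
        intro s hs
        by_contra! hall
        have : s = Finset.univ := Finset.eq_univ_iff_forall.2 hall
        have hcard : Fintype.card (S : Set V) = S.card := by simp
        rw [this, Finset.card_univ, hcard] at hs
        omega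
      · by_cases h1 : S.card = 1
        · obtain ⟨v, rfl⟩ := Finset.card_eq_one.1 h1
          exact K5Tree.single v
        · have hle := degSum_le (G := G) (S := S)
          have h5 : S.card = 5 := by
            have : S.card ≤ 5 := by omega
            interval_cases S.card <;> omega
          refine K5Tree.clique S h5 fun u hu v hv huv => ?_
          by_contra hn
          have := degSum_lt hu hv huv hn
          rw [h5] at this hd
          omega
    · obtain ⟨S₁, S₂, hs, hn₁, hn₂, h₁, h₂⟩ := exists_separates hsep
      -- The two upper bounds add up to the lower bound `hd` if there is a common vertex, which
      -- makes both parts dense. Without one they contradict `hd`.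
      have u₁ := upper S₁ h₁ hn₁
      have u₂ := upper S₂ h₂ hn₂
      rw [hs.degSum_eq] at hd
      rcases hs.card_eq with ⟨v, hv₁, hv₂, hc⟩ | hc
      · exact K5Tree.glue S S₁ S₂ v (ih S₁ h₁ hn₁ (by omega)) (ih S₂ h₂ hn₂ (by omega)) hs hv₁ hv₂
      · omega

/-! ### Blocks -/

theorem not_isCutVertex_of_preconnected {W : Type*} [Finite W] {H : SimpleGraph W} {v : W}
    (h : (H.induce ({v} : Set W)ᶜ).Preconnected) : ¬ IsCutVertex H v := by
  have : Nonempty H.ConnectedComponent := ⟨H.connectedComponentMk v⟩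
  have h₁ : Nat.card (H.induce ({v} : Set W)ᶜ).ConnectedComponent ≤ 1 :=
    Finite.card_le_one_iff_subsingleton.2 h.subsingleton_connectedComponent
  have h₂ : 0 < Nat.card H.ConnectedComponent := Nat.card_pos
  rw [IsCutVertex, IsCut, not_lt]
  omega

theorem isCutVertex_of_not_reachable {W : Type*} [Finite W] {H : SimpleGraph W} {v : W}
    (hc : H.Preconnected) {a b : ({v} : Set W)ᶜ.Elem}
    (h : ¬ (H.induce ({v} : Set W)ᶜ).Reachable a b) : IsCutVertex H v := by
  have h₁ : Nat.card H.ConnectedComponent ≤ 1 :=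
    Finite.card_le_one_iff_subsingleton.2 hc.subsingleton_connectedComponent
  have h₂ : 1 < Nat.card (H.induce ({v} : Set W)ᶜ).ConnectedComponent := by
    rw [Finite.one_lt_card_iff_nontrivial]
    exact ⟨⟨connectedComponentMk _ a, connectedComponentMk _ b,
      fun he => h (ConnectedComponent.exact he)⟩⟩
  rw [IsCutVertex, IsCut]
  omega

/-- A connected subgraph without cut-vertices lies on one side of a separation. -/
theorem Separates.verts_subset [Finite V] {S S₁ S₂ : Finset V} (h : Separates G S S₁ S₂) {v : V}
    (hv₁ : v ∈ S₁) (hv₂ : v ∈ S₂) {H : G.Subgraph} (hH : H.Connected)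
    (hcut : ∀ w : H.verts, ¬ IsCutVertex H.coe w) (hHS : H.verts ⊆ S) :
    H.verts ⊆ S₁ ∨ H.verts ⊆ S₂ := by
  by_contra hno
  rw [not_or, Set.not_subset, Set.not_subset] at hno
  obtain ⟨⟨b, hb, hb₁⟩, ⟨a, ha, ha₂⟩⟩ := hno
  have hb₂ : b ∈ S₂ := ((h.mem b).1 (hHS hb)).resolve_left hb₁
  -- A walk in `H` that enters `S₂` does so at `v`. Thus `v` belongs to `H`, and its deletion
  -- separates `a` from `b`.
  have cross : ∀ x y : H.verts, H.coe.Adj x y → x.1 ∉ S₂ → y.1 ∈ S₂ → y.1 = v := by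
    intro x y hxy hx hy
    have hx₁ := ((h.mem x).1 (hHS x.2)).resolve_right hx
    exact h.inter _ _ ((h.cross x hx₁ y hy (H.adj_sub hxy)).resolve_left hx) hy hv₁ hv₂
  have hpre : H.coe.Preconnected := (Subgraph.connected_iff'.1 hH).preconnected
  obtain ⟨p⟩ := hpre ⟨a, ha⟩ ⟨b, hb⟩
  obtain ⟨d, -, hd₁, hd₂⟩ := p.exists_boundary_dart {x | x.1 ∉ S₂} ha₂ (by simpa using hb₂)
  have hd := cross _ _ d.adj hd₁ (by simpa using hd₂)
  have hvH : v ∈ H.verts := hd ▸ d.snd.2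
  refine hcut ⟨v, hvH⟩ (isCutVertex_of_not_reachable hpre
    (a := ⟨⟨a, ha⟩, fun hav => ha₂ ?_⟩) (b := ⟨⟨b, hb⟩, fun hbv => hb₁ ?_⟩) ?_)
  · have : a = v := congrArg Subtype.val hav
    exact this ▸ hv₂
  · have : b = v := congrArg Subtype.val hbv
    exact this ▸ hv₁
  · rintro ⟨q⟩
    obtain ⟨d, -, hd₁, hd₂⟩ := q.exists_boundary_dart {x | x.1.1 ∉ S₂} ha₂ (by simpa using hb₂)
    exact d.snd.2 (Subtype.ext (cross d.fst.1 d.snd.1 d.adj hd₁ (by simpa using hd₂)))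

/-- A block stays on one side at every gluing. If that side is a single vertex, this vertex also
lies on the other side, where the induction continues. -/
theorem K5Tree.verts_subset_clique [Finite V] {S : Finset V} (h : K5Tree G S) {H : G.Subgraph}
    (hH : H.Connected) (hcut : ∀ w : H.verts, ¬ IsCutVertex H.coe w) (hHS : H.verts ⊆ S) :
    (∃ v, S = {v}) ∨ ∃ Q : Finset V, Q.card = 5 ∧ (∀ u ∈ Q, ∀ v ∈ Q, u ≠ v → G.Adj u v) ∧
      H.verts ⊆ Q := by
  induction h with
  | single v => exact Or.inl ⟨v, rfl⟩
  | clique Q hQ hadj => exact Or.inr ⟨Q, hQ, hadj, hHS⟩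
  | glue S S₁ S₂ v _ _ h hv₁ hv₂ ih₁ ih₂ =>
    have both : ∀ x, S₁ = {x} → ∀ y, S₂ = {y} → S = {v} := by
      rintro x rfl y rfl
      rw [Finset.mem_singleton] at hv₁ hv₂
      subst hv₁ hv₂
      ext z
      simp [h.mem]
    rcases h.verts_subset hv₁ hv₂ hH hcut hHS with hs | hs
    · rcases ih₁ hs with ⟨x, hx⟩ | hQ
      · have hs' : H.verts ⊆ S₂ := by
          intro z hz
          have hz' := hs hz
          rw [hx] at hz' hv₁
          rw [Finset.coe_singleton, Set.mem_singleton_iff] at hz'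
          rw [Finset.mem_singleton] at hv₁
          rw [hz', ← hv₁]
          exact hv₂
        rcases ih₂ hs' with ⟨y, hy⟩ | hQ
        exacts [Or.inl ⟨v, both x hx y hy⟩, Or.inr hQ]
      · exact Or.inr hQ
    · rcases ih₂ hs with ⟨x, hx⟩ | hQ
      · have hs' : H.verts ⊆ S₁ := by
          intro z hz
          have hz' := hs hz
          rw [hx] at hz' hv₂
          rw [Finset.coe_singleton, Set.mem_singleton_iff] at hz'
          rw [Finset.mem_singleton] at hv₂
          rw [hz', ← hv₂]
          exact hv₁
        rcases ih₁ hs' with ⟨y, hy⟩ | hQ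
        exacts [Or.inl ⟨v, both y hy x hx⟩, Or.inr hQ]
      · exact Or.inr hQ

theorem preconnected_of_forall_adj {W : Type*} {H : SimpleGraph W}
    (h : ∀ a b, a ≠ b → H.Adj a b) : H.Preconnected := fun a b => by
  by_cases hab : a = b
  · rw [hab]
  · exact (h a b hab).reachable

/-- The subgraph induced on `Q` is connected without cut-vertices, so the maximal `B` equals it. -/
theorem IsBlock.isK5_of_subset_clique [Finite V] {B : G.Subgraph} (hB : IsBlock G B) {Q : Finset V}
    (hQ : Q.card = 5) (hadj : ∀ u ∈ Q, ∀ v ∈ Q, u ≠ v → G.Adj u v) (hBQ : B.verts ⊆ Q) :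
    IsK5 B := by
  set H : G.Subgraph := (⊤ : G.Subgraph).induce (Q : Set V) with hH
  have hHadj : ∀ a b : H.verts, a ≠ b → H.coe.Adj a b := fun a b hab =>
    ⟨a.2, b.2, hadj a a.2 b b.2 fun h => hab (Subtype.ext h)⟩
  have hle : B ≤ H :=
    ⟨hBQ, fun a b hab => ⟨hBQ (B.edge_vert hab), hBQ (B.edge_vert hab.symm), B.adj_sub hab⟩⟩
  have hne : Nonempty H.verts := by
    obtain ⟨q, hq⟩ := Finset.card_pos.1 (by omega : 0 < Q.card)
    exact ⟨⟨q, hq⟩⟩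
  have hprop : H.Connected ∧ ∀ v : H.verts, ¬ IsCutVertex H.coe v := by
    refine ⟨Subgraph.connected_iff'.2 ⟨preconnected_of_forall_adj hHadj⟩, fun v => ?_⟩
    exact not_isCutVertex_of_preconnected (preconnected_of_forall_adj fun a b hab =>
      hHadj a b fun h => hab (Subtype.ext h))
  have hBH : B = H := Maximal.eq_of_le hB hprop hle
  rw [hBH]
  have hcard : Nat.card H.verts = 5 := by
    rw [← hQ]
    exact (Nat.card_coe_set_eq _).trans (Set.ncard_coe_finset Q)
  refine ⟨⟨Finite.equivFinOfCardEq hcard, fun {a b} => ?_⟩⟩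
  rw [top_adj, ne_eq, EmbeddingLike.apply_eq_iff_eq]
  exact ⟨hHadj a b, fun h => h.ne⟩

/-- Every cycle lies in a block. -/
theorem HasCycleOfLength.exists_isBlock [Finite V] {m : ℕ} (h : HasCycleOfLength G m) :
    ∃ B : G.Subgraph, IsBlock G B ∧ m ≤ Nat.card B.verts := by
  obtain ⟨f, hf⟩ := h.exists_runsAround
  have h3 := hf.three_le
  -- The graph induced on the vertices of the cycle has no cut-vertex; by finiteness it extends to a
  -- maximal such subgraph.
  set H : G.Subgraph := (⊤ : G.Subgraph).induce (Set.range f) with hH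
  have hmem : ∀ i, f i ∈ H.verts := fun i => ⟨i, rfl⟩
  have hadj : ∀ i, H.coe.Adj ⟨f i, hmem i⟩ ⟨f (i + 1), hmem (i + 1)⟩ := fun i =>
    ⟨hmem i, hmem (i + 1), hf.adj i⟩
  have hconn : H.Connected := by
    have : Nonempty H.verts := ⟨⟨f 0, hmem 0⟩⟩
    refine Subgraph.connected_iff'.2 ⟨?_⟩
    have key : ∀ i, H.coe.Reachable ⟨f 0, hmem 0⟩ ⟨f i, hmem i⟩ := by
      intro i
      induction i with
      | zero => exact Reachable.refl _
      | succ i ih => exact ih.trans (hadj i).reachable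
    rintro ⟨_, i, rfl⟩ ⟨_, j, rfl⟩
    exact (key i).symm.trans (key j)
  have hcut : ∀ v : H.verts, ¬ IsCutVertex H.coe v := by
    rintro ⟨_, i, rfl⟩
    refine not_isCutVertex_of_preconnected ?_
    -- Without `f i`, the vertices `f (i + 1), …, f (i + m - 1)` still form a walk through all the
    -- others.
    have hne : ∀ e, 1 ≤ e → e < m → (⟨f (i + e), hmem _⟩ : H.verts) ∈
        ({⟨f i, hmem i⟩} : Set H.verts)ᶜ := by
      intro e he hem heq
      have := hf.eq_of_lt (by omega : i ≤ i + e) (by omega) (congrArg Subtype.val heq).symm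
      omega
    have key : ∀ e (he : 1 ≤ e) (hem : e < m),
        (H.coe.induce ({⟨f i, hmem i⟩} : Set H.verts)ᶜ).Reachable
          ⟨_, hne 1 le_rfl (by omega)⟩ ⟨_, hne e he hem⟩ := by
      intro e he
      induction e, he using Nat.le_induction with
      | base => exact fun _ => Reachable.refl _
      | succ e he ih =>
        intro hem
        refine (ih (by omega)).trans (Adj.reachable ?_)
        exact hadj (i + e)
    have all : ∀ x, (H.coe.induce ({⟨f i, hmem i⟩} : Set H.verts)ᶜ).Reachable
        ⟨_, hne 1 le_rfl (by omega)⟩ x := by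
      rintro ⟨⟨_, j, rfl⟩, hj⟩
      obtain ⟨e, he, hje⟩ := hf.exists_offset i j
      have he1 : 1 ≤ e := by
        rcases Nat.eq_zero_or_pos e with rfl | h0
        · exact absurd (Subtype.ext hje) hj
        · exact h0
      convert key e he1 he using 2
      exact Subtype.ext hje
    exact fun x y => (all x).symm.trans (all y)
  obtain ⟨B, hHB, hB⟩ := Finite.exists_le_maximal
    (p := fun H : G.Subgraph => H.Connected ∧ ∀ v : H.verts, ¬ IsCutVertex H.coe v) ⟨hconn, hcut⟩
  refine ⟨B, hB, ?_⟩
  have hinj : Function.Injective fun i : Fin m => (⟨f i, hHB.1 (hmem i)⟩ : B.verts) := by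
    intro i j hij
    have := (hf.inj i j).1 (congrArg Subtype.val hij)
    rw [Nat.ModEq, Nat.mod_eq_of_lt i.2, Nat.mod_eq_of_lt j.2] at this
    exact Fin.ext this
  simpa using Nat.card_le_card_of_injective _ hinj

end EvenCycles

/-! ### The theorem -/

theorem theorem1p3 {V : Type*} [Fintype V] (G : SimpleGraph V) [DecidableRel G.Adj]
    (hn : 2 ≤ Fintype.card V)
    (he : (5 / 2 : ℝ) * ((Fintype.card V : ℝ) - 1) ≤ (G.edgeFinset.card : ℝ)) :
    EvenCycles.HasTwoConsecutiveEvenCycles G ↔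
      ¬ ((4 : ℤ) ∣ (Fintype.card V : ℤ) - 1 ∧
        ∀ B : G.Subgraph, EvenCycles.IsBlock G B → EvenCycles.IsK5 B) := by
  constructor
  · rintro ⟨m, hm, h₁, h₂⟩ ⟨-, hB⟩
    obtain ⟨B, hBlock, hcard⟩ := h₂.exists_isBlock
    obtain ⟨e⟩ := hB B hBlock
    rw [Nat.card_congr e.toEquiv, Nat.card_eq_fintype_card, Fintype.card_fin] at hcard
    -- An even `m ≥ 3` is at least 4, so `m + 2 ≥ 6` exceeds the five vertices of the block.
    have h3 := h₁.exists_path.1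
    obtain ⟨r, hr⟩ := hm
    omega
  · intro h
    by_contra hP
    refine h ?_
    have hdeg : 5 * Fintype.card V ≤ 2 * G.edgeFinset.card + 5 := by
      have : (5 * Fintype.card V : ℝ) ≤ 2 * G.edgeFinset.card + 5 := by linarith
      exact_mod_cast this
    have hne : (Finset.univ : Finset V).Nonempty :=
      Finset.card_pos.1 (by rw [Finset.card_univ]; omega)
    have htree := EvenCycles.k5Tree_of_dense hP Finset.univ hne
      (by rw [EvenCycles.degSum_univ, Finset.card_univ]; exact hdeg)
    constructor
    · obtain ⟨k, hk⟩ := htree.card_eq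
      rw [Finset.card_univ] at hk
      exact ⟨k, by rw [hk]; push_cast; ring⟩
    · intro B hB
      rcases htree.verts_subset_clique hB.prop.1 hB.prop.2 (by simp) with ⟨v, hv⟩ | ⟨Q, hQ, hadj, hBQ⟩
      · have := congrArg Finset.card hv
        rw [Finset.card_univ, Finset.card_singleton] at this
        omega
      · exact hB.isK5_of_subset_clique hQ hadj hBQ
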